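/- For a prime power $q$ let $\mathbb{F}_q$ be the field with $q$ elements. A linear code of length $n$ over $\mathbb{F}_q$ is a linear subspace $\mathcal{C}\le\mathbb{F}_q^n$. Its homogeneous weight enumerator is $$W_{\mathcal{C}}(x,y)=\sum_{c\in\mathcal{C}}x^{n-\mathrm{wt}(c)}y^{\mathrm{wt}(c)}\in\mathbb{C}[x,y],$$ where $\mathrm{wt}(c)$ is the number of nonzero coordinates of $c$, and its dual $\mathcal{C}^\perp$ is the orthogonal space of $\mathcal{C}$ for the standard bilinear form $\sum_i v_iw_i$. The Reed-Muller code is $$\mathrm{RM}_q(r,m)=\{(p(v))_{v\in\mathbb{F}_q^m} : p\in\mathbb{F}_q[x_1,\dots,x_m],\ \deg p\le r\},$$ and, for a set $R\subset\mathbb{F}_q^{m+1}\setminus\{0\}$ of representatives of all the points of $\mathbb{P}^m(\mathbb{F}_q)$, the projective Reed-Muller code is $$\mathrm{PRM}_q(r,m)=\{(p(v))_{v\in R} : p\in\mathbb{F}_q[x_0,\dots,x_m]\text{ homogeneous of degree } r,\text{ or } p=0\}.$$ The group $\mathrm{GL}_2(\mathbb{C})$ acts on $\mathbb{C}[x,y]$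 by $A\cdot p(x,y)=p(ax+by,cx+dy)$ for $A=\begin{pmatrix}a&b\\c&d\end{pmatrix}$. The stabilizer of $p$ in $\mathrm{GL}_2(\mathbb{C})$ is $\{A : A\cdot p=p\}$, and its stabilizer in $\mathrm{PGL}_2(\mathbb{C})$ is the set of classes of the matrices $A$ with $A\cdot p=\lambda p$ for some $\lambda\in\mathbb{C}^\times$. **Theorem.** The homogeneous weight enumerator of each of the codes $$\mathrm{RM}_4(2,2),\quad \mathrm{RM}_4(3,2),\quad \mathrm{RM}_5(2,2),\quad \mathrm{PRM}_5(3,2),\quad \mathrm{PRM}_5(3,2)^\perp=\mathrm{PRM}_5(5,2)$$ has trivial stabilizer in $\mathrm{PGL}_2(\mathbb{C})$, and its stabilizer in $\mathrm{GL}_2(\mathbb{C})$ consists only of scalar matrices. For the projective codes this, including the equality $\mathrm{PRM}_5(3,2)^\perp=\mathrm{PRM}_5(5,2)$, holds for every choice of the set $R$ of representatives of the points of $\mathbb{P}^2(\mathbb{F}_5)$ (the same $R$ in both codes of the equality). -/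

import Mathlib

open scoped MatrixGroups LinearAlgebra.Projectivization

/-! ### Linear codes

A linear code over `F` whose coordinates are indexed by a finite type `ι` is a
`Submodule F (ι → F)`; its length is `Fintype.card ι`. -/

section Codes

variable {F : Type*} [Field F] {ι : Type*}

/-- The dual code `C^⊥ = {v | ⟨v, c⟩ = 0 for all c ∈ C}` for the standard bilinear form. -/
def dualCode [Fintype ι] (C : Submodule F (ι → F)) : Submodule F (ι → F) where
  carrier := {v | ∀ c ∈ C, v ⬝ᵥ c = 0}
  add_mem' := by
    intro v w hv hw c hc
    rw [add_dotProduct, hv c hc, hw c hc, add_zero]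
  zero_mem' := by
    intro c _
    exact zero_dotProduct c
  smul_mem' := by
    intro a v hv c hc
    rw [smul_dotProduct, hv c hc, smul_zero]

open Classical in
/-- The homogeneous weight enumerator `W_C(x, y) = ∑_{c ∈ C} x^(n - wt c) y^(wt c)`, with
`x = X 0` and `y = X 1`, as a polynomial with complex coefficients. -/
noncomputable def weightEnumerator [Fintype F] [Fintype ι] (C : Submodule F (ι → F)) :
    MvPolynomial (Fin 2) ℂ :=
  ∑ c : C, MvPolynomial.X 0 ^ (Fintype.card ι - hammingNorm (c : ι → F)) *
    MvPolynomial.X 1 ^ hammingNorm (c : ι → F)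

/-- The linear map sending a polynomial `p` to the vector `(p(P i))_i` of its values at the
points of a family `P`. -/
noncomputable def evalAt {σ : Type*} (P : ι → σ → F) : MvPolynomial σ F →ₗ[F] (ι → F) :=
  LinearMap.pi fun i => (MvPolynomial.aeval (P i)).toLinearMap

variable (F)

/-- The Reed-Muller code `RM_q(r, m)`: the values on all of `F^m` of the polynomials in `m`
variables of total degree at most `r`. -/
noncomputable def reedMuller (r m : ℕ) : Submodule F ((Fin m → F) → F) :=
  (MvPolynomial.restrictTotalDegree (Fin m) F r).map (evalAt fun v : Fin m → F => v)

variable {F}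

/-- `R` is a set of representatives of all the points of `ℙ^m(F)`: it consists of nonzero
vectors, and each point of the projective space is the class of exactly one of them. -/
def IsProjectiveRepresentatives {m : ℕ} (R : Finset (Fin (m + 1) → F)) : Prop :=
  ∃ h : ∀ v : R, (v : Fin (m + 1) → F) ≠ 0,
    Function.Bijective fun v : R => Projectivization.mk F (v : Fin (m + 1) → F) (h v)

/-- The projective Reed-Muller code `PRM_q(r, m)` with respect to the set `R` of representatives
of the points of `ℙ^m(F)`: the values on `R` of the homogeneous polynomials of degree `r` in
`m + 1` variables (the zero polynomial included). -/
noncomputable def projReedMuller (r m : ℕ) (R : Finset (Fin (m + 1) → F)) :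
    Submodule F (R → F) :=
  (MvPolynomial.homogeneousSubmodule (Fin (m + 1)) F r).map
    (evalAt fun v : R => (v : Fin (m + 1) → F))

end Codes

/-! ### The action of `GL₂(ℂ)` on `ℂ[x, y]` and stabilizers -/

/-- The substitution `p(x, y) ↦ p(a x + b y, c x + d y)` for the matrix `A` with rows
`(a, b)` and `(c, d)`. -/
noncomputable def linSubst (A : Matrix (Fin 2) (Fin 2) ℂ) :
    MvPolynomial (Fin 2) ℂ →ₐ[ℂ] MvPolynomial (Fin 2) ℂ :=
  MvPolynomial.aeval fun i =>
    MvPolynomial.C (A i 0) * MvPolynomial.X 0 + MvPolynomial.C (A i 1) * MvPolynomial.X 1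

theorem linSubst_one (p : MvPolynomial (Fin 2) ℂ) : linSubst 1 p = p := by
  have h : linSubst 1 = AlgHom.id ℂ (MvPolynomial (Fin 2) ℂ) := by
    apply MvPolynomial.algHom_ext
    intro i
    fin_cases i <;> simp [linSubst]
  rw [h, AlgHom.id_apply]

theorem linSubst_mul (A B : Matrix (Fin 2) (Fin 2) ℂ) (p : MvPolynomial (Fin 2) ℂ) :
    linSubst (A * B) p = linSubst B (linSubst A p) := by
  have h : linSubst (A * B) = (linSubst B).comp (linSubst A) := by
    apply MvPolynomial.algHom_ext
    intro i
    simp only [linSubst, AlgHom.comp_apply, MvPolynomial.aeval_X, map_add, map_mul,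
      MvPolynomial.aeval_C, MvPolynomial.algebraMap_eq, Matrix.mul_apply, Fin.sum_univ_two]
    ring
  rw [h, AlgHom.comp_apply]

/-- The stabilizer of `p` in `GL₂(ℂ)`. -/
noncomputable def polyStabilizer (p : MvPolynomial (Fin 2) ℂ) : Subgroup (GL (Fin 2) ℂ) where
  carrier := {A | linSubst (A : Matrix (Fin 2) (Fin 2) ℂ) p = p}
  one_mem' := linSubst_one p
  mul_mem' := by
    intro A B hA hB
    simp only [Set.mem_ofPred_eq] at hA hB ⊢
    rw [Units.val_mul, linSubst_mul, hA, hB]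
  inv_mem' := by
    intro A hA
    simp only [Set.mem_ofPred_eq] at hA ⊢
    conv_lhs => rw [← hA]
    rw [← linSubst_mul, Units.mul_inv, linSubst_one]

/-- The subgroup of those `A ∈ GL₂(ℂ)` that preserve `p` up to a nonzero constant factor. -/
noncomputable def lineStabilizer (p : MvPolynomial (Fin 2) ℂ) : Subgroup (GL (Fin 2) ℂ) where
  carrier := {A | ∃ c : ℂˣ, linSubst (A : Matrix (Fin 2) (Fin 2) ℂ) p = (c : ℂ) • p}
  one_mem' := ⟨1, by simpa using linSubst_one p⟩
  mul_mem' := by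
    rintro A B ⟨a, hA⟩ ⟨b, hB⟩
    refine ⟨a * b, ?_⟩
    rw [Units.val_mul, linSubst_mul, hA, map_smul, hB, smul_smul, Units.val_mul]
  inv_mem' := by
    rintro A ⟨a, hA⟩
    refine ⟨a⁻¹, ?_⟩
    have h : linSubst ((A⁻¹ : GL (Fin 2) ℂ) : Matrix (Fin 2) (Fin 2) ℂ) ((a : ℂ) • p) = p := by
      rw [← hA, ← linSubst_mul, Units.mul_inv, linSubst_one]
    rw [map_smul] at h
    conv_rhs => rw [← h]
    rw [smul_smul, Units.inv_mul, one_smul]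

/-- The stabilizer of `p` in `PGL₂(ℂ)`: the classes of the matrices that preserve `p` up to a
nonzero constant factor, i.e. that fix the line spanned by `p`. -/
noncomputable def projStabilizer (p : MvPolynomial (Fin 2) ℂ) : Subgroup PGL(2, ℂ) :=
  (lineStabilizer p).map Matrix.ProjGenLinGroup.mk

/-- `p` has trivial stabilizer: its stabilizer in `PGL₂(ℂ)` is the trivial group, and its
stabilizer in `GL₂(ℂ)` consists only of scalar matrices. -/
def HasTrivialStabilizer (p : MvPolynomial (Fin 2) ℂ) : Prop :=
  projStabilizer p = ⊥ ∧
    ∀ A ∈ polyStabilizer p, ∃ c : ℂ,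
      (A : Matrix (Fin 2) (Fin 2) ℂ) = Matrix.scalar (Fin 2) c

/-! ### Stabilizers of binary forms and the Hessian covariant -/

section Stabilizer

open MvPolynomial

/-! A code of length `n` and minimum distance `d` has enumerator `x ^ n + y ^ d * K`. If `d` is
large, the Hessian of this form, a covariant, has a root of multiplicity at least `d - 2` at `(1 :
0)`. A matrix that preserves the form up to a factor permutes the roots of the Hessian with their
multiplicities. So if no other root has multiplicity `d - 2` or more, the matrix fixes `(1 : 0)` and
is upper triangular. Since `x ^ (n - 1) * y` does not occur in the form, the matrix is diagonal; two
neighbouring nonzero coefficients then make its diagonal entries equal. This is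
`hasTrivialStabilizer_of_hessian`.

The bound on the multiplicities is certified over the integers. A Bézout identity modulo a prime
shows that the dehomogenized Hessian shares no complex root with its `j`-th derivative, for some `j
< d - 2` (`not_pow_dvd_map_of_coprime_derivative`).

This settles `RM_4(2,2)`, `RM_5(2,2)` and `PRM_5(3,2)`, once their weight distributions are known.
The other two codes are dual to the first and the third, by a vanishing character sum or power sum
and a dimension count. By MacWilliams a dual enumerator is a multiple of an invertible linear
transform of the original one, so its stabilizer is conjugate.

The weight distributions come from exhaustive counts. Transitivity on the coordinates reduces the
count to words with entry `1` at a fixed coordinate (`mul_weightCount`). These words are enumerated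
through their generating function at one large integer, whose digits are the counts
(`card_filter_eq_of_sum_pow_eq_ofDigits`). For cubics a shear removes the quadratic term in the last
variable, which divides the work by 25, and points are grouped by the lines through `(0 : 0 : 1)`.
-/

theorem hasTrivialStabilizer_iff {p : MvPolynomial (Fin 2) ℂ} :
    HasTrivialStabilizer p ↔ ∀ A ∈ lineStabilizer p, ∃ c : ℂ,
      (A : Matrix (Fin 2) (Fin 2) ℂ) = Matrix.scalar (Fin 2) c := by
  have key : projStabilizer p = ⊥ ↔ ∀ A ∈ lineStabilizer p, ∃ c : ℂ,
      (A : Matrix (Fin 2) (Fin 2) ℂ) = Matrix.scalar (Fin 2) c := by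
    rw [projStabilizer, Subgroup.map_eq_bot_iff, Matrix.ProjGenLinGroup.ker_mk]
    refine forall₂_congr fun A _ => ?_
    rw [Matrix.GeneralLinearGroup.mem_center_iff_val_mem_range_scalar]
    simp only [Set.mem_range, eq_comm]
  refine ⟨fun h => key.1 h.1, fun h => ⟨key.2 h, fun A hA => h A ⟨1, ?_⟩⟩⟩
  rw [Units.val_one, one_smul]
  exact hA

/-- A form proportional to a linear transform of a form with trivial stabilizer has trivial
stabilizer. -/
theorem HasTrivialStabilizer.smul_linSubst {p : MvPolynomial (Fin 2) ℂ}
    (hp : HasTrivialStabilizer p) {c : ℂ} (hc : c ≠ 0) (g : GL (Fin 2) ℂ) :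
    HasTrivialStabilizer (c • linSubst (g : Matrix (Fin 2) (Fin 2) ℂ) p) := by
  rw [hasTrivialStabilizer_iff] at hp ⊢
  rintro A ⟨l, hA⟩
  -- `linSubst` is a right action by `linSubst_mul`, hence this order of the conjugation.
  have hmem : g * A * g⁻¹ ∈ lineStabilizer p := by
    refine ⟨l, ?_⟩
    rw [map_smul, smul_comm] at hA
    have h := smul_right_injective _ hc hA
    rw [Units.val_mul, Units.val_mul, linSubst_mul, linSubst_mul, h, map_smul, ← linSubst_mul,
      Units.mul_inv, linSubst_one]
  obtain ⟨d, hd⟩ := hp _ hmem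
  refine ⟨d, ?_⟩
  have : (A : Matrix (Fin 2) (Fin 2) ℂ) = (g⁻¹ : GL (Fin 2) ℂ) * (g * A * g⁻¹ : GL (Fin 2) ℂ) * g := by
    rw [← Units.val_mul, ← Units.val_mul]
    congr 1
    group
  rw [this, hd, (Matrix.scalar_commute d (fun _ => Commute.all _ _) _).symm.eq, mul_assoc, Units.inv_mul,
    mul_one]

/-- The Hessian determinant of a polynomial in two variables. -/
noncomputable def hessian (p : MvPolynomial (Fin 2) ℂ) : MvPolynomial (Fin 2) ℂ :=
  pderiv 0 (pderiv 0 p) * pderiv 1 (pderiv 1 p) - pderiv 0 (pderiv 1 p) ^ 2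

theorem pderiv_linSubst (A : Matrix (Fin 2) (Fin 2) ℂ) (i : Fin 2) (p : MvPolynomial (Fin 2) ℂ) :
    pderiv i (linSubst A p) =
      C (A 0 i) * linSubst A (pderiv 0 p) + C (A 1 i) * linSubst A (pderiv 1 p) := by
  induction p using MvPolynomial.induction_on with
  | C a => simp [linSubst, MvPolynomial.algebraMap_eq]
  | add p q hp hq => simp only [map_add, hp, hq]; ring
  | mul_X p j hp =>
    have hX : pderiv i (linSubst A (X j)) = C (A j i) := by
      fin_cases i <;> simp [linSubst, pderiv_X]
    rw [map_mul, Derivation.leibniz, hp, hX, Derivation.leibniz, Derivation.leibniz]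
    fin_cases j <;> simp [pderiv_X, smul_eq_mul] <;> ring

/-- The commutator of two derivations is a derivation, and this one kills every variable. -/
theorem pderiv_pderiv_comm {σ R : Type*} [CommRing R] (i j : σ) (p : MvPolynomial σ R) :
    pderiv i (pderiv j p) = pderiv j (pderiv i p) := by
  classical
  let D (l : σ) : Derivation R (MvPolynomial σ R) (MvPolynomial σ R) := pderiv l
  have h : ⁅D i, D j⁆ = 0 := by
    refine MvPolynomial.derivation_ext fun l => ?_
    rw [Derivation.commutator_apply]
    simp [D, pderiv_X, Pi.single_apply, apply_ite]
  have := DFunLike.congr_fun h p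
  rwa [Derivation.commutator_apply, Derivation.coe_zero, Pi.zero_apply, sub_eq_zero] at this

/-- By the chain rule the matrix of second derivatives becomes `Aᵀ H A`; take determinants. -/
theorem hessian_linSubst (A : Matrix (Fin 2) (Fin 2) ℂ) (p : MvPolynomial (Fin 2) ℂ) :
    hessian (linSubst A p) = C (A.det ^ 2) * linSubst A (hessian p) := by
  have hc := pderiv_pderiv_comm (1 : Fin 2) 0 p
  simp only [hessian, pderiv_linSubst, map_add, Derivation.leibniz, pderiv_C,
    smul_eq_mul, map_sub, map_mul, map_pow, hc, Matrix.det_fin_two]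
  ring

theorem hessian_smul (c : ℂ) (p : MvPolynomial (Fin 2) ℂ) :
    hessian (c • p) = c ^ 2 • hessian p := by
  simp only [hessian, Derivation.map_smul]
  simp only [smul_eq_C_mul, C_pow]
  ring

/-- Dehomogenization `p(x, y) ↦ p(X, 1)`. -/
noncomputable def dehom : MvPolynomial (Fin 2) ℂ →ₐ[ℂ] Polynomial ℂ :=
  aeval ![Polynomial.X, 1]

theorem dehom_X_zero : dehom (X 0) = Polynomial.X := by simp [dehom]

theorem dehom_X_one : dehom (X 1) = 1 := by simp [dehom]

theorem dehom_pderiv_zero (p : MvPolynomial (Fin 2) ℂ) :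
    dehom (pderiv 0 p) = Polynomial.derivative (dehom p) := by
  induction p using MvPolynomial.induction_on with
  | C a => simp
  | add p q hp hq => simp only [map_add, hp, hq]
  | mul_X p j hp =>
    fin_cases j <;>
      simp [pderiv_X, hp, dehom_X_zero, dehom_X_one, Polynomial.derivative_mul]
    ring

theorem dehom_pderiv_one {p : MvPolynomial (Fin 2) ℂ} {n : ℕ} (hp : p.IsHomogeneous n) :
    dehom (pderiv 1 p) = n • dehom p - Polynomial.X * Polynomial.derivative (dehom p) := by
  have h := congrArg dehom hp.sum_X_mul_pderiv
  rw [Fin.sum_univ_two, map_add, map_mul, map_mul, dehom_X_zero, dehom_X_one, dehom_pderiv_zero,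
    map_nsmul] at h
  rw [← h]
  ring

/-- Euler's relation, applied to `p` and to its `y`-derivative, expresses the `y`-derivatives on `y
= 1` through `f = p(X, 1)`, `f'` and `f''`. -/
theorem dehom_hessian {p : MvPolynomial (Fin 2) ℂ} {n : ℕ} (hp : p.IsHomogeneous (n + 1)) :
    dehom (hessian p) = Polynomial.C (n : ℂ) *
      ((n + 1 : ℕ) • (dehom p * Polynomial.derivative^[2] (dehom p)) -
        n • Polynomial.derivative (dehom p) ^ 2) := by
  have h1 : (pderiv 1 p).IsHomogeneous n := by simpa using hp.pderiv (i := 1)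
  simp only [hessian, map_sub, map_mul, map_pow, dehom_pderiv_zero, dehom_pderiv_one h1,
    dehom_pderiv_one hp, Polynomial.derivative_mul, Function.iterate_succ,
    Function.iterate_zero, Function.comp, id, nsmul_eq_mul, Polynomial.derivative_natCast,
    Polynomial.derivative_X, map_natCast]
  push_cast
  ring

/-- The term `x ^ n` survives only in the second `x`-derivative, whose cofactor is the second
`y`-derivative; two derivatives lower the power of `y` by at most two. -/
theorem X_pow_dvd_hessian {p K : MvPolynomial (Fin 2) ℂ} {n k : ℕ}
    (hp : p = X 0 ^ n + X 1 ^ (k + 2) * K) : X 1 ^ k ∣ hessian p := by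
  have h1 : X 1 ^ k ∣ pderiv 1 (pderiv 1 p) := by
    subst hp
    simp only [map_add, Derivation.leibniz, Derivation.leibniz_pow, pderiv_X, Pi.single_apply,
      smul_eq_mul, nsmul_eq_mul]
    simp only [Fin.isValue, zero_ne_one, if_true, if_false, mul_one, mul_zero, map_zero,
      Derivation.map_natCast, Derivation.map_one_eq_zero, zero_add, add_tsub_cancel_right, add_zero,
      show k + 2 - 1 = k + 1 from rfl]
    refine ⟨X 1 ^ 2 * pderiv 1 (pderiv 1 K) + 2 * ((k : MvPolynomial (Fin 2) ℂ) + 2) * X 1 *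
      pderiv 1 K + ((k : MvPolynomial (Fin 2) ℂ) + 2) * ((k : MvPolynomial (Fin 2) ℂ) + 1) * K, ?_⟩
    push_cast
    ring
  have h2 : X 1 ^ k ∣ pderiv 0 (pderiv 1 p) := by
    subst hp
    simp only [map_add, Derivation.leibniz, Derivation.leibniz_pow, pderiv_X, Pi.single_apply,
      smul_eq_mul, nsmul_eq_mul]
    simp only [Fin.isValue, zero_ne_one, one_ne_zero, if_true, if_false, mul_one, mul_zero, map_zero,
      Derivation.map_natCast, Derivation.map_one_eq_zero, zero_add, add_tsub_cancel_right, add_zero,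
      show k + 2 - 1 = k + 1 from rfl]
    refine ⟨X 1 ^ 2 * pderiv 0 (pderiv 1 K) + ((k : MvPolynomial (Fin 2) ℂ) + 2) * X 1 * pderiv 0 K, ?_⟩
    push_cast
    ring
  exact dvd_sub (Dvd.dvd.mul_left h1 _) (Dvd.dvd.pow h2 two_ne_zero)

/-- By covariance `A` carries the factor `y ^ k` of the Hessian to `(c x + d y) ^ k`, again a
factor. If `c ≠ 0`, this is a second root, `-d / c`, in the affine chart. -/
theorem exists_pow_dvd_dehom_hessian {p : MvPolynomial (Fin 2) ℂ} {k : ℕ}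
    (hp : X 1 ^ k ∣ hessian p) {A : GL (Fin 2) ℂ} (hA : A ∈ lineStabilizer p)
    (hA10 : (A : Matrix (Fin 2) (Fin 2) ℂ) 1 0 ≠ 0) :
    ∃ r : ℂ, (Polynomial.X - Polynomial.C r) ^ k ∣ dehom (hessian p) := by
  obtain ⟨l, hl⟩ := hA
  have h := congrArg hessian hl
  rw [hessian_linSubst, hessian_smul] at h
  have h1 : linSubst A (X 1) ^ k ∣ hessian p := by
    rw [← map_pow]
    have h2 : linSubst (A : Matrix (Fin 2) (Fin 2) ℂ) (X 1 ^ k) ∣ (l : ℂ) ^ 2 • hessian p :=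
      h ▸ Dvd.dvd.mul_left (map_dvd _ hp) _
    rw [smul_eq_C_mul] at h2
    refine (IsUnit.dvd_mul_left ?_).1 h2
    exact (IsUnit.mk0 _ (pow_ne_zero 2 l.ne_zero)).map C
  have h2 := map_dvd dehom h1
  rw [map_pow] at h2
  set c := (A : Matrix (Fin 2) (Fin 2) ℂ) 1 0 with hc
  set d := (A : Matrix (Fin 2) (Fin 2) ℂ) 1 1 with hd
  refine ⟨-(d / c), dvd_trans (pow_dvd_pow_of_dvd ?_ k) h2⟩
  have h3 : dehom (linSubst A (X 1)) = Polynomial.C c * Polynomial.X + Polynomial.C d := by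
    simp [linSubst, dehom_X_zero, dehom_X_one, hc, hd]
  rw [h3]
  refine ⟨Polynomial.C c, ?_⟩
  rw [sub_mul, ← Polynomial.C_mul, neg_mul, div_mul_cancel₀ _ hA10, Polynomial.C_neg]
  ring

theorem det_eq_of_apply_one_zero {A : GL (Fin 2) ℂ}
    (h : (A : Matrix (Fin 2) (Fin 2) ℂ) 1 0 = 0) :
    (A : Matrix (Fin 2) (Fin 2) ℂ) 0 0 ≠ 0 ∧ (A : Matrix (Fin 2) (Fin 2) ℂ) 1 1 ≠ 0 := by
  have hdet : (A : Matrix (Fin 2) (Fin 2) ℂ).det ≠ 0 := by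
    have := A.isUnit
    rw [Matrix.isUnit_iff_isUnit_det] at this
    exact this.ne_zero
  rw [Matrix.det_fin_two, h, mul_zero, sub_zero] at hdet
  exact ⟨left_ne_zero_of_mul hdet, right_ne_zero_of_mul hdet⟩

theorem apply_zero_one_eq_zero {p K : MvPolynomial (Fin 2) ℂ} {n k : ℕ} (hn : n ≠ 0)
    (hp : p = X 0 ^ n + X 1 ^ (k + 2) * K) {A : GL (Fin 2) ℂ} (hA : A ∈ lineStabilizer p)
    (hA10 : (A : Matrix (Fin 2) (Fin 2) ℂ) 1 0 = 0) :
    (A : Matrix (Fin 2) (Fin 2) ℂ) 0 1 = 0 := by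
  obtain ⟨l, hl⟩ := hA
  have ha := (det_eq_of_apply_one_zero hA10).1
  -- This functional reads off the coefficient of `x ^ (n - 1) * y`: it is `n * a ^ (n - 1) * b` on
  -- the left and zero on the right.
  have h := congrArg (fun q => (Polynomial.derivative
    (aeval ![(1 : Polynomial ℂ), Polynomial.X] q)).eval 0) hl
  subst hp
  simp only [linSubst, map_add, map_mul, map_pow, aeval_X, Fin.isValue, map_smul, hA10] at h
  simpa [Polynomial.derivative_mul, Polynomial.derivative_pow, hn, ha] using h

theorem linSubst_monomial_of_diagonal {A : Matrix (Fin 2) (Fin 2) ℂ} (h10 : A 1 0 = 0)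
    (h01 : A 0 1 = 0) (m : Fin 2 →₀ ℕ) (c : ℂ) :
    linSubst A (monomial m c) = (A 0 0 ^ m 0 * A 1 1 ^ m 1) • monomial m c := by
  rw [linSubst, aeval_monomial, Finsupp.prod_fintype _ _ (by simp), monomial_eq,
    Finsupp.prod_fintype _ _ (by simp)]
  simp only [Fin.prod_univ_two, h10, h01, algebraMap_eq, smul_eq_C_mul, map_mul, map_pow, map_zero]
  ring

theorem coeff_linSubst_of_diagonal {A : Matrix (Fin 2) (Fin 2) ℂ} (h10 : A 1 0 = 0)
    (h01 : A 0 1 = 0) (m : Fin 2 →₀ ℕ) (p : MvPolynomial (Fin 2) ℂ) :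
    coeff m (linSubst A p) = A 0 0 ^ m 0 * A 1 1 ^ m 1 * coeff m p := by
  induction p using MvPolynomial.induction_on' with
  | monomial u c =>
    rw [linSubst_monomial_of_diagonal h10 h01, coeff_smul, coeff_monomial, smul_eq_mul]
    split_ifs with h
    · rw [h]
    · simp
  | add p q hp hq => rw [map_add, coeff_add, coeff_add, hp, hq, mul_add]

/-- A form `x ^ n + y ^ (k + 2) * K`, with two nonzero neighbouring coefficients, whose Hessian has
no root other than `(1 : 0)` of multiplicity at least `k` has trivial stabilizer. -/
theorem hasTrivialStabilizer_of_hessian {p K : MvPolynomial (Fin 2) ℂ} {n k : ℕ} (hn : n ≠ 0)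
    (hp : p = X 0 ^ n + X 1 ^ (k + 2) * K)
    (hroot : ∀ r : ℂ, ¬ (Polynomial.X - Polynomial.C r) ^ k ∣ dehom (hessian p))
    {i j : ℕ} (hi : coeff (Finsupp.single 0 (i + 1) + Finsupp.single 1 j) p ≠ 0)
    (hj : coeff (Finsupp.single 0 i + Finsupp.single 1 (j + 1)) p ≠ 0) :
    HasTrivialStabilizer p := by
  rw [hasTrivialStabilizer_iff]
  intro A hA
  have h10 : (A : Matrix (Fin 2) (Fin 2) ℂ) 1 0 = 0 := by
    by_contra h
    obtain ⟨r, hr⟩ := exists_pow_dvd_dehom_hessian (X_pow_dvd_hessian hp) hA h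
    exact hroot r hr
  have h01 := apply_zero_one_eq_zero hn hp hA h10
  obtain ⟨h00, h11⟩ := det_eq_of_apply_one_zero h10
  obtain ⟨l, hl⟩ := hA
  -- A diagonal matrix scales each monomial by itself, and all monomials that occur are scaled by
  -- the same `l`; two neighbours give the ratio of the entries.
  have key : ∀ m : Fin 2 →₀ ℕ, coeff m p ≠ 0 →
      (A : Matrix (Fin 2) (Fin 2) ℂ) 0 0 ^ m 0 * (A : Matrix (Fin 2) (Fin 2) ℂ) 1 1 ^ m 1 = l := by
    intro m hm
    have := congrArg (coeff m) hl
    rw [coeff_linSubst_of_diagonal h10 h01, coeff_smul, smul_eq_mul] at this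
    exact mul_right_cancel₀ hm this
  have h1 := key _ hi
  have h2 := key _ hj
  simp only [Finsupp.add_apply, Finsupp.single_apply, Fin.isValue, if_true, one_ne_zero, if_false,
    zero_ne_one, add_zero, zero_add] at h1 h2
  have h3 : (A : Matrix (Fin 2) (Fin 2) ℂ) 0 0 = (A : Matrix (Fin 2) (Fin 2) ℂ) 1 1 := by
    rw [← h2, pow_succ, pow_succ] at h1
    refine mul_left_cancel₀ (mul_ne_zero (pow_ne_zero i h00) (pow_ne_zero j h11)) ?_
    linear_combination h1
  refine ⟨(A : Matrix (Fin 2) (Fin 2) ℂ) 0 0, ?_⟩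
  ext a b
  fin_cases a <;> fin_cases b <;> simp [h10, h01, h3]

end Stabilizer

/-! ### Bounding root multiplicities by a certificate modulo a prime -/

section Certificate

open Polynomial

/-- An integer polynomial whose leading coefficient is prime to `p` and which is coprime to its
`j`-th derivative modulo `p` has no complex root of multiplicity more than `j`. -/
theorem not_pow_dvd_map_of_coprime_derivative {H U V W : ℤ[X]} {p j k : ℕ} (hp : p.Prime)
    (hjk : j < k) (hlead : ¬ (p : ℤ) ∣ H.leadingCoeff)
    (h : U * H + V * derivative^[j] H = 1 + (p : ℤ[X]) * W) (r : ℂ) :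
    ¬ (X - C r) ^ k ∣ H.map (Int.castRingHom ℂ) := by
  intro hr
  have hroot : ∀ i < k, aeval r (derivative^[i] H) = 0 := by
    intro i hi
    have h1 := dvd_trans (pow_dvd_pow (X - C r) (by omega : i + 1 ≤ k)) hr
    have h2 : (X - C r) ∣ derivative^[i] (H.map (Int.castRingHom ℂ)) := by
      have := Polynomial.pow_sub_dvd_iterate_derivative_of_pow_dvd i h1
      simpa using this
    rw [dvd_iff_isRoot, IsRoot.def, Polynomial.iterate_derivative_map, eval_map] at h2
    rw [aeval_def, ← h2]
    rfl
  have h1 := congrArg (aeval r) h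
  rw [map_add, map_mul, map_mul, hroot j hjk, show H = derivative^[0] H from rfl,
    hroot 0 (by omega), mul_zero, mul_zero, map_add, map_one, map_mul, map_natCast] at h1
  have hp0 : (p : ℂ) ≠ 0 := Nat.cast_ne_zero.2 hp.ne_zero
  -- At `r` the identity reads `p * W(r) = -1`. As `L * r` is an algebraic integer, so is `L ^ deg W
  -- * W(r)`, that is `-L ^ deg W / p`; being rational it is an integer, so `p` divides `L`.
  set L := H.leadingCoeff with hL
  have hint : IsIntegral ℤ (L • r) := isIntegral_leadingCoeff_smul H r (hroot 0 (by omega))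
  have hint2 : IsIntegral ℤ (aeval (L • r) (W.scaleRoots L)) :=
    adjoin_le_integralClosure hint (aeval_mem_adjoin_singleton ℤ (L • r))
  have hscale : aeval (L • r) (W.scaleRoots L) = (L : ℂ) ^ W.natDegree * aeval r W := by
    have := scaleRoots_eval₂_mul (p := W) (algebraMap ℤ ℂ) r L
    simpa [aeval_def, zsmul_eq_mul] using this
  have hq : IsIntegral ℤ ((L : ℚ) ^ W.natDegree / p) := by
    have hneg := hint2.neg
    rw [hscale] at hneg
    have : -((L : ℂ) ^ W.natDegree * aeval r W) = algebraMap ℚ ℂ ((L : ℚ) ^ W.natDegree / p) := by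
      simp only [map_div₀, map_pow, map_intCast, map_natCast]
      rw [eq_div_iff hp0]
      linear_combination (L : ℂ) ^ W.natDegree * h1
    rw [this] at hneg
    exact (isIntegral_algebraMap_iff (algebraMap ℚ ℂ).injective).1 hneg
  obtain ⟨z, hz⟩ := IsIntegrallyClosed.isIntegral_iff.1 hq
  have hz' : L ^ W.natDegree = z * p := by
    have hp0' : (p : ℚ) ≠ 0 := Nat.cast_ne_zero.2 hp.ne_zero
    rw [eq_div_iff hp0'] at hz
    have : ((z * p : ℤ) : ℚ) = ((L ^ W.natDegree : ℤ) : ℚ) := by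
      push_cast
      exact hz
    exact_mod_cast this.symm
  have hdvd : (p : ℤ) ∣ L ^ W.natDegree := ⟨z, by rw [hz', mul_comm]⟩
  exact hlead ((Nat.prime_iff_prime_int.1 hp).dvd_of_dvd_pow hdvd)

/-- The polynomial with a given list of coefficients, the constant coefficient first. -/
noncomputable def listPoly : List ℤ → ℤ[X]
  | [] => 0
  | a :: l => C a + X * listPoly l

/-- Addition of coefficient lists. -/
def listAdd : List ℤ → List ℤ → List ℤ
  | [], m => m
  | a :: l, [] => a :: l
  | a :: l, b :: m => (a + b) :: listAdd l m

/-- Multiplication of a coefficient list by an integer. -/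
def listScale (c : ℤ) (l : List ℤ) : List ℤ := l.map (c * ·)

/-- Multiplication of coefficient lists. -/
def listMul : List ℤ → List ℤ → List ℤ
  | [], _ => []
  | a :: l, m => listAdd (listScale a m) (0 :: listMul l m)

/-- The coefficient list of the derivative. -/
def listDeriv : List ℤ → List ℤ
  | [] => []
  | _ :: l => listAdd l (0 :: listDeriv l)

theorem listPoly_add (l m : List ℤ) : listPoly (listAdd l m) = listPoly l + listPoly m := by
  induction l generalizing m with
  | nil => simp [listAdd, listPoly]
  | cons a l ih =>
    cases m with
    | nil => simp [listAdd, listPoly]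
    | cons b m =>
      simp only [listAdd, listPoly, ih, C_add]
      ring

theorem listPoly_scale (c : ℤ) (l : List ℤ) : listPoly (listScale c l) = C c * listPoly l := by
  induction l with
  | nil => simp [listScale, listPoly]
  | cons a l ih =>
    simp only [listScale, List.map_cons, listPoly, C_mul] at ih ⊢
    rw [ih]
    ring

theorem listPoly_mul (l m : List ℤ) : listPoly (listMul l m) = listPoly l * listPoly m := by
  induction l with
  | nil => simp [listMul, listPoly]
  | cons a l ih =>
    simp only [listMul, listPoly_add, listPoly_scale, listPoly, ih, C_0]
    ring

theorem listPoly_deriv (l : List ℤ) : listPoly (listDeriv l) = derivative (listPoly l) := by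
  induction l with
  | nil => simp [listDeriv, listPoly]
  | cons a l ih =>
    simp [listDeriv, listPoly_add, listPoly, ih]

theorem listPoly_iterate_deriv (j : ℕ) (l : List ℤ) :
    listPoly (listDeriv^[j] l) = derivative^[j] (listPoly l) := by
  induction j generalizing l with
  | zero => rfl
  | succ j ih => rw [Function.iterate_succ_apply, ih, listPoly_deriv, Function.iterate_succ_apply]

theorem listPoly_append (l m : List ℤ) :
    listPoly (l ++ m) = listPoly l + X ^ l.length * listPoly m := by
  induction l with
  | nil => simp [listPoly]
  | cons a l ih =>
    simp only [List.cons_append, listPoly, ih, List.length_cons]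
    ring

theorem listPoly_replicate_zero (m : ℕ) : listPoly (List.replicate m 0) = 0 := by
  induction m with
  | zero => rfl
  | succ m ih => simp [List.replicate_succ, listPoly, ih]

theorem degree_listPoly_lt (l : List ℤ) : (listPoly l).degree < l.length := by
  induction l with
  | nil => simp [listPoly]
  | cons a l ih =>
    rw [listPoly, List.length_cons]
    refine lt_of_le_of_lt (degree_add_le _ _) (max_lt ?_ ?_)
    · exact lt_of_le_of_lt degree_C_le (by exact_mod_cast Nat.succ_pos _)
    · by_cases h : listPoly l = 0
      · simp only [h, mul_zero, degree_zero]
        exact WithBot.bot_lt_coe _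
      · rw [X_mul, degree_mul_X, degree_eq_natDegree h]
        rw [degree_eq_natDegree h] at ih
        have : (listPoly l).natDegree < l.length := by exact_mod_cast ih
        exact_mod_cast Nat.succ_lt_succ this

theorem leadingCoeff_listPoly_append (l : List ℤ) {a : ℤ} (ha : a ≠ 0) :
    (listPoly (l ++ [a])).leadingCoeff = a := by
  have h : listPoly (l ++ [a]) = listPoly l + C a * X ^ l.length := by
    rw [listPoly_append]
    simp only [listPoly]
    ring
  rw [h, leadingCoeff_add_of_degree_lt, leadingCoeff_C_mul_X_pow]
  rw [degree_C_mul_X_pow _ ha]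
  exact degree_listPoly_lt l

/-- The coefficients of `n f f'' - (n - 1) f' ^ 2`, for the list of coefficients of `f` and
`m = n - 1`. -/
def listHessian (m : ℕ) (l : List ℤ) : List ℤ :=
  listAdd (listScale (m + 1) (listMul l (listDeriv (listDeriv l))))
    (listScale (-m) (listMul (listDeriv l) (listDeriv l)))

theorem listPoly_listHessian (m : ℕ) (l : List ℤ) : listPoly (listHessian m l) =
    (m + 1 : ℕ) • (listPoly l * derivative^[2] (listPoly l)) -
      m • derivative (listPoly l) ^ 2 := by
  simp only [listHessian, listPoly_add, listPoly_scale, listPoly_mul, listPoly_deriv,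
    Function.iterate_succ, Function.iterate_zero, Function.comp, id, nsmul_eq_mul]
  simp only [C_neg, C_add, map_natCast, Nat.cast_add, Nat.cast_one, C_1]
  ring

/-- `listDeriv` keeps the length of a list and leading terms of the Hessian cancel, so the computed
list ends in zeros; splitting them off exposes the true leading coefficient `a`. -/
theorem not_pow_dvd_map_listHessian {m p j k z : ℕ} {l h u v w : List ℤ} {a : ℤ} (hp : p.Prime)
    (hjk : j < k) (hpa : ¬ (p : ℤ) ∣ a) (hh : listHessian m l = (h ++ [a]) ++ List.replicate z 0)
    (hcert : listAdd (listMul u (h ++ [a])) (listMul v (listDeriv^[j] (h ++ [a]))) =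
      listAdd [1] (listScale p w)) (r : ℂ) :
    ¬ (X - C r) ^ k ∣ (listPoly (listHessian m l)).map (Int.castRingHom ℂ) := by
  have ha : a ≠ 0 := by
    rintro rfl
    exact hpa (dvd_zero _)
  rw [hh, listPoly_append (h ++ [a]), listPoly_replicate_zero, mul_zero, add_zero]
  refine not_pow_dvd_map_of_coprime_derivative (U := listPoly u) (V := listPoly v)
    (W := listPoly w) hp hjk (by rwa [leadingCoeff_listPoly_append _ ha]) ?_ r
  have := congrArg listPoly hcert
  rw [listPoly_add, listPoly_mul, listPoly_mul, listPoly_iterate_deriv, listPoly_add,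
    listPoly_scale] at this
  simpa [listPoly] using this

end Certificate

/-! ### Forms given by a weight distribution -/

section WeightForm

open MvPolynomial

/-- The form `∑ i, A i * x ^ (n - i) * y ^ i`, for the list `A` of its `n + 1` coefficients. -/
noncomputable def weightForm (A : List ℕ) : MvPolynomial (Fin 2) ℂ :=
  ∑ i ∈ Finset.range A.length, C (A.getD i 0 : ℂ) * (X 0 ^ (A.length - 1 - i) * X 1 ^ i)

theorem isHomogeneous_weightForm (A : List ℕ) : (weightForm A).IsHomogeneous (A.length - 1) := by
  refine IsHomogeneous.sum _ _ _ fun i hi => ?_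
  rw [Finset.mem_range] at hi
  have h := ((isHomogeneous_X_pow (R := ℂ) (0 : Fin 2) (A.length - 1 - i)).mul
    (isHomogeneous_X_pow (1 : Fin 2) i)).C_mul (A.getD i 0 : ℂ)
  rwa [Nat.sub_add_cancel (by omega)] at h

theorem coeff_weightForm (A : List ℕ) {i j : ℕ} (h : i + j + 1 = A.length) :
    coeff (Finsupp.single 0 i + Finsupp.single 1 j) (weightForm A) = A.getD j 0 := by
  rw [weightForm, coeff_sum, Finset.sum_eq_single j]
  · have : A.length - 1 - j = i := by omega
    rw [this, coeff_C_mul, X_pow_eq_monomial, X_pow_eq_monomial, monomial_mul, coeff_monomial]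
    simp
  · intro b _ hb
    rw [coeff_C_mul, X_pow_eq_monomial, X_pow_eq_monomial, monomial_mul, coeff_monomial, if_neg,
      mul_zero]
    intro h
    have := DFunLike.congr_fun h 1
    simp at this
    exact hb this
  · intro hj
    rw [Finset.mem_range] at hj
    omega

theorem exists_weightForm_eq {A : List ℕ} {k : ℕ} (h0 : A.getD 0 0 = 1)
    (h : ∀ i < k + 2, 0 < i → A.getD i 0 = 0) (hk : k + 2 ≤ A.length) :
    ∃ K, weightForm A = X 0 ^ (A.length - 1) + X 1 ^ (k + 2) * K := by
  obtain ⟨M, hM⟩ := Nat.exists_eq_add_of_le hk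
  refine ⟨∑ i ∈ Finset.range M, C (A.getD (k + 2 + i) 0 : ℂ) *
    (X 0 ^ (A.length - 1 - (k + 2 + i)) * X 1 ^ i), ?_⟩
  rw [weightForm, show Finset.range A.length = Finset.range (k + 2 + M) by rw [hM],
    Finset.sum_range_add, Finset.sum_eq_single 0]
  · rw [h0, Finset.mul_sum]
    congr 1
    · simp
    · refine Finset.sum_congr rfl fun i _ => ?_
      rw [pow_add]
      ring
  · intro i hi hi0
    rw [h i (Finset.mem_range.1 hi) (Nat.pos_of_ne_zero hi0)]
    simp
  · simp

theorem listPoly_eq_sum (l : List ℤ) :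
    listPoly l = ∑ i ∈ Finset.range l.length, Polynomial.C (l.getD i 0) * Polynomial.X ^ i := by
  induction l with
  | nil => simp [listPoly]
  | cons a l ih =>
    rw [List.length_cons, Finset.sum_range_succ', listPoly, ih, Finset.mul_sum, add_comm]
    congr 1
    · refine Finset.sum_congr rfl fun i _ => ?_
      rw [List.getD_cons_succ, pow_succ]
      ring
    · simp

/-- Setting `y = 1` turns weight `i` into the exponent `n - i`, hence the reversed list. -/
theorem dehom_weightForm (A : List ℕ) : dehom (weightForm A) =
    (listPoly (A.reverse.map Int.ofNat)).map (Int.castRingHom ℂ) := by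
  rw [listPoly_eq_sum, List.length_map, List.length_reverse, weightForm, map_sum,
    Polynomial.map_sum, ← Finset.sum_range_reflect]
  refine Finset.sum_congr rfl fun i hi => ?_
  rw [Finset.mem_range] at hi
  have h1 : A.length - 1 - (A.length - 1 - i) = i := by omega
  have h2 : (A.reverse.map Int.ofNat).getD i 0 = (A.getD (A.length - 1 - i) 0 : ℤ) := by
    rw [List.getD_eq_getElem _ _ (by simpa using hi), List.getD_eq_getElem _ _ (by omega)]
    simp
  rw [h1, h2, map_mul, map_mul, map_pow, map_pow, dehom_X_zero, dehom_X_one]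
  simp

/-- A criterion for trivial stabilizers that is checked by computing with integers. -/
theorem hasTrivialStabilizer_weightForm {A : List ℕ} {m k p j z i : ℕ} {h u v w : List ℤ} {a : ℤ}
    (hm : A.length = m + 2) (hm0 : m ≠ 0) (hk : k ≤ m) (h0 : A.getD 0 0 = 1)
    (hA : ∀ i < k + 2, 0 < i → A.getD i 0 = 0)
    (hi : i ≤ m) (hi0 : A.getD i 0 ≠ 0) (hi1 : A.getD (i + 1) 0 ≠ 0)
    (hp : p.Prime) (hjk : j < k) (hpa : ¬ (p : ℤ) ∣ a)
    (hh : listHessian m (A.reverse.map Int.ofNat) = (h ++ [a]) ++ List.replicate z 0)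
    (hcert : listAdd (listMul u (h ++ [a])) (listMul v (listDeriv^[j] (h ++ [a]))) =
      listAdd [1] (listScale p w)) :
    HasTrivialStabilizer (weightForm A) := by
  obtain ⟨K, hK⟩ := exists_weightForm_eq h0 hA (by omega)
  refine hasTrivialStabilizer_of_hessian (i := m - i) (j := i) (by omega) hK (fun r hr => ?_) ?_ ?_
  · have hhom := isHomogeneous_weightForm A
    rw [hm, show m + 2 - 1 = m + 1 from rfl] at hhom
    rw [dehom_hessian hhom] at hr
    refine not_pow_dvd_map_listHessian hp hjk hpa hh hcert r ?_
    rw [listPoly_listHessian]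
    have hu : IsUnit (Polynomial.C (m : ℂ)) :=
      (IsUnit.mk0 _ (Nat.cast_ne_zero.2 hm0)).map Polynomial.C
    rw [hu.dvd_mul_left, dehom_weightForm] at hr
    simpa [Polynomial.derivative_map] using hr
  · rw [coeff_weightForm _ (by omega)]
    exact_mod_cast hi0
  · rw [coeff_weightForm _ (by omega)]
    exact_mod_cast hi1

end WeightForm

/-! ### Certificates for the three weight distributions -/

theorem hasTrivialStabilizer_weightForm_affineConicFour :
    HasTrivialStabilizer (weightForm [1, 0, 0, 0, 0, 0, 0, 0, 90, 480, 0, 864, 840, 1440, 0, 288, 93]) :=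
  -- Minimum weight 8 gives `k = 6`; weights 8 and 9 both occur. Modulo 11 the Hessian is coprime to
  -- its second derivative: `u` and `v` are Bézout coefficients and `w` is the quotient of the error
  -- by 11.
  hasTrivialStabilizer_weightForm (m := 15) (k := 6) (p := 11) (j := 2) (z := 10) (i := 8)
    (h := [-1244160, 12856320, 17487360, 43130880, -38568960, -57093120, -4803840, -46863360,
      54328320, 44928000, -14376960, 1244160, -14515200, -4838400, -161280, 967680, 0,
      3594240, 1774080, 1520640, 0, 552960])
    (a := 80640)
    (u := [2, 4, -3, 5, 1, 4, 3, 4, -2, 5, 0, 1, 4, -1, -4, -2, 0, 4, -4])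
    (v := [2, -3, -3, 3, 4, 3, -5, 1, 0, -2, 1, 0, -3, 2, -2, 2, 4, -4, -1, -2, 4, -2])
    (w := [6132829, 39398400, -156072960, -132295680, 504368640, -57231360, 718640640,
      -398891520, -2623898880, 75375360, 1301011200, 2962206720, -218430720, -1914969600,
      481259520, -1373840640, 165104640, 1128672000, -1769909760, 399916800, 984407040,
      -945584640, 3169152000, -537937920, -1240945920, -1354602240, 115372800, 993876480,
      -613382400, 575377920, -474577920, 357891840, 57162240, -54408960, -416701440,
      299877120, -146027520, 55180800, -139968000, 77506560, -28707840, -6773760, 0, 0])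
    (by decide) (by decide) (by decide) (by decide) (by decide) (by decide) (by decide) (by decide)
    (by norm_num) (by decide) (by norm_num) (by decide +kernel) (by decide +kernel)

theorem hasTrivialStabilizer_weightForm_affineConicFive :
    HasTrivialStabilizer (weightForm [1, 0, 0, 0, 0, 0, 0, 0, 0, 0, 0, 0, 0, 0, 0, 240, 1500, 0, 0, 4000, 2640, 6000, 0, 0,
      1000, 244]) :=
  -- Minimum weight 15 gives `k = 13`; weights 15 and 16 both occur. The Bézout identity is modulo
  -- 13, again with the second derivative.
  hasTrivialStabilizer_weightForm (m := 24) (k := 13) (p := 13) (j := 2) (z := 17) (i := 15)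
    (h := [-24000000, 0, 439200000, 970080000, 1418400000, 1848000000, -3024000000, -1875600000,
      -961200000, -1581600000, -1824000000, 3348000000, 1461600000, -30240000, 115200000, 0,
      -324000000, -97200000, -8640000, 0, 0, 0, 0, 3660000, 13800000, 0, 0, 63000000,
      25080000, 34200000, 0, 0, 9000000])
    (a := 1260000)
    (u := [2, -6, -3, 6, 1, 6, -4, 3, 3, 0, -1, -4, -1, -6, 2, -3, 1, -2, -3, 5, 4, -5, 1, -2,
      -4, 2, 3, -6, 1, -2, 1])
    (v := [1, -5, 5, 0, 2, -3, 1, 6, 0, -5, 5, -6, 1, 2, -2, 0, 6, 6, -6, 6, 2, 6, -3, -4, -4,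
      2, -6, -6, -6, 2, 3, 6, 4])
    (w := [63876923, 120960000, -518400000, -1529280000, -14844960000, 43338240000, -8548320000,
      -14136480000, -5338080000, 66683760000, -171550320000, 9066000000, 26952240000,
      90143040000, -138902640000, -28944000000, 225850320000, 95638320000, -157857840000,
      187435200000, -145203120000, -200616120000, 97049880000, -80891760000, -188269080000,
      86406300000, 226837560000, -168975420000, 74862480000, 130404840000, 242776980000,
      107748660000, 32493120000, -84727860000, 111727920000, -107488080000, -303654000000,
      -313211340000, -115019460000, -9391140000, 187409220000, 268466760000, 142608660000,
      15518820000, 6653820000, -42756360000, 1473000000, -1476000000, -13864260000,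
      -26707200000, -8839680000, -20138640000, -23723700000, -40945620000, -15593460000,
      1269900000, 25117440000, 24037440000, 13915320000, 9302940000, 2265120000, 4426380000,
      3361680000, 409500000, 0, 0])
    (by decide) (by decide) (by decide) (by decide) (by decide) (by decide) (by decide) (by decide)
    (by norm_num) (by decide) (by norm_num) (by decide +kernel) (by decide +kernel)

theorem hasTrivialStabilizer_weightForm_planeCubicFive :
    HasTrivialStabilizer (weightForm [1, 0, 0, 0, 0, 0, 0, 0, 0, 0, 0, 0, 0, 0, 0, 2480, 15500, 0, 0, 124000, 78120,
      558000, 744000, 1116000, 1519000, 1867564, 1488000, 1116000, 744000, 372000, 4960,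
      16000]) :=
  -- Minimum weight 15 again; here the Bézout identity modulo 13 uses the third derivative.
  hasTrivialStabilizer_weightForm (m := 30) (k := 13) (p := 13) (j := 3) (z := 17) (i := 15)
    (h := [368285952000, 2107127040000, -1361698560000, -15506388480000, -35442910080000,
      -52195511059200, -11963204544000, 34232142336000, 61262873568000, 41621294400000,
      102469382685600, 31412429952000, 28253307744000, -17235081408000, -77341433760000,
      -95595860937600, -55511173248000, -36402833760000, -1644924480000, 39254236080000,
      24341994691200, 21661708800000, 8038265280000, 4498863840000, 896036400000,
      -324372096000, 3690240000, 0, -57660000000, -16836720000, -1342324800, 9363984000,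
      17436384000, 24286392000, 29983200000, 34736690400, 25993128000, 17505576000,
      10655568000, 7265160000, 920253600, 1314648000, 0, 0, 115320000])
    (a := 16144800)
    (u := [-1, 1, -1, -6, -4, -6, -6, 0, 6, -5, -4, -5, 3, 2, 6, -1, -4, 0, 4, 5, 6, -3, -1, 2,
      6, 6, 2, -5, -5, 5, 3, -3, 5, -1, 3, -2, -3, 4, -1, 4, 0, 4])
    (v := [6, -3, 6, -5, 0, 6, -4, 3, 6, 2, 0, -6, 2, -2, 1, -3, 0, 2, -5, -3, -6, 3, 5, 2, 3,
      5, -6, 2, 2, 0, -3, -6, 2, 1, 3, -1, -5, 5, -2, -1, 4, 5, 4, -6, 3])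
    (w := [-42969097787077, -371261761536000, -1291817223168000, -295928833152000,
      2531476963200000, 8342800804550400, 8443650561657600, 34762136210054400,
      -804328825017600, 38694277641657600, -30881298752896800, -61991914939922400,
      -73709150554471200, -84124038497745600, -43227453766780800, 61037921228817600,
      67580265340209600, 17241757651824000, 63949931128017600, -176849657298477600,
      -152424992247849600, -72663972468304800, -48558868351744800, 130266077932795200,
      171919102944465600, 188589798638632800, 114782014440720000, -19194384325123200,
      21984318160608000, 16728981300554400, 150578254391280000, 139008933326632800,
      172241724771165600, -14474190181080000, -170717890260480000, -302000317001344800,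
      -403336657687524000, -196658864292297600, -37671449007400800, 44142990361322400,
      137283458133384000, 212400131155934400, 144462726736440000, 166969031238602400,
      90842162684832000, 17892327970620000, -83015241266724000, -89523001788854400,
      -18348415498495200, -3481227022850400, 69500769546784800, -33796613884744800,
      -182368918810989600, -139847208155083200, -157637135579832000, -41233745171479200,
      17630796438801600, 152725154362881600, 150028183591219200, 26154367143948000,
      72135567699237600, 3737472200532000, 22315226990908800, -3636012543621600,
      4456830405758400, 4163390028290400, -1632574215408000, -597362754804000,
      363451576152000, 88676937705600, 341337210981600, 489085224964800, 750860577859200,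
      932140220532000, 672539509924800, 436848376298400, 364475230276800, 206177392120800,
      111841552099200, -11154998162400, 91713700780800, -23505133596000, 23352083198400,
      3348341570400, -3806491785600, 1480339776000, 317213030400, 0, 0, 0])
    (by decide) (by decide) (by decide) (by decide) (by decide) (by decide) (by decide) (by decide)
    (by norm_num) (by decide) (by norm_num) (by decide +kernel) (by decide +kernel)

/-! ### The MacWilliams identity and duality of stabilizers -/

section MacWilliams

theorem AddChar.map_sum_eq_prod {A M κ : Type*} [AddCommMonoid A] [CommMonoid M] (ψ : AddChar A M)
    (s : Finset κ) (f : κ → A) : ψ (∑ i ∈ s, f i) = ∏ i ∈ s, ψ (f i) :=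
  map_prod ψ.toMonoidHom (fun i => Multiplicative.ofAdd (f i)) s

open MvPolynomial

variable {F : Type*} [Field F] [Fintype F] {ι : Type*} [Fintype ι]

open Classical in
theorem weightEnumerator_eq_sum_prod (C : Submodule F (ι → F)) :
    weightEnumerator C = ∑ c : C, ∏ i, if (c : ι → F) i = 0 then X 0 else X 1 := by
  refine Finset.sum_congr rfl fun c _ => ?_
  rw [Finset.prod_ite, Finset.prod_const, Finset.prod_const, hammingNorm]
  congr 2
  rw [← Finset.card_univ, ← Finset.card_filter_add_card_filter_not (p := fun i => (c : ι → F) i = 0)]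
  exact Nat.add_sub_cancel _ _

open Classical in
-- If `v` is not in the dual code, a multiple of some word has product `1` with `v`, so `c ↦ ψ (v ⬝ᵥ
-- c)` is a nontrivial character of `C` and sums to zero.
theorem sum_addChar_dotProduct (C : Submodule F (ι → F)) {ψ : AddChar F ℂ} (hψ : ψ 1 ≠ 1)
    (v : ι → F) :
    ∑ c : C, ψ (v ⬝ᵥ (c : ι → F)) = if v ∈ dualCode C then (Fintype.card C : ℂ) else 0 := by
  split_ifs with hv
  · rw [Finset.sum_congr rfl fun c _ => by rw [hv c c.2, AddChar.map_zero_eq_one]]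
    simp
  · obtain ⟨c, hc, hvc⟩ : ∃ c ∈ C, v ⬝ᵥ c ≠ 0 := by
      by_contra! h
      exact hv h
    let χ : AddChar C ℂ :=
      { toFun := fun c => ψ (v ⬝ᵥ (c : ι → F))
        map_zero_eq_one' := by simp
        map_add_eq_mul' := fun a b => by
          rw [Submodule.coe_add, dotProduct_add, AddChar.map_add_eq_mul] }
    refine AddChar.sum_eq_zero_of_ne_one (ψ := χ) fun h => hψ ?_
    have h1 := DFunLike.congr_fun h ((v ⬝ᵥ c)⁻¹ • ⟨c, hc⟩ : C)
    have h2 : ψ (v ⬝ᵥ ((v ⬝ᵥ c)⁻¹ • c)) = 1 := h1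
    rwa [dotProduct_smul, smul_eq_mul, inv_mul_cancel₀ hvc] at h2

open Classical in
/-- The MacWilliams identity. -/
theorem card_smul_weightEnumerator_dualCode (C : Submodule F (ι → F)) :
    (Fintype.card C : ℂ) • weightEnumerator (dualCode C) =
      linSubst !![1, (Fintype.card F : ℂ) - 1; 1, -1] (weightEnumerator C) := by
  obtain ⟨ψ, hψ⟩ := AddChar.exists_apply_ne_zero.2 (one_ne_zero (α := F))
  set φ : F → MvPolynomial (Fin 2) ℂ := fun t => if t = 0 then X 0 else X 1 with hφ
  -- The Fourier transform at a single coordinate: `x + (q - 1) y` at `s = 0` and `x - y` elsewhere.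
  -- The identity is the product of these over the coordinates.
  have htransform : ∀ s : F, ∑ t, MvPolynomial.C (ψ (t * s)) * φ t =
      linSubst !![1, (Fintype.card F : ℂ) - 1; 1, -1] (φ s) := by
    intro s
    have h1 : ∑ t, MvPolynomial.C (ψ (t * s)) * φ t =
        MvPolynomial.C (∑ t, ψ (t * s)) * X 1 + (X 0 - X 1) := by
      rw [map_sum, Finset.sum_mul, ← sub_eq_iff_eq_add', ← Finset.sum_sub_distrib,
        Finset.sum_eq_single 0]
      · simp [hφ]
      · intro t _ ht
        simp [hφ, ht]
      · simp
    rw [h1]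
    by_cases hs : s = 0
    · subst hs
      simp [hφ, linSubst]
      ring
    · have h2 : ∑ t, ψ (t * s) = 0 := by
        rw [Fintype.sum_equiv (Equiv.mulRight₀ s hs) (fun t => ψ (t * s)) ψ (fun t => rfl)]
        exact AddChar.sum_eq_zero_of_ne_one fun h => hψ (by rw [h]; rfl)
      rw [h2]
      simp [hφ, hs, linSubst]
      ring
  calc (Fintype.card C : ℂ) • weightEnumerator (dualCode C)
      = ∑ v : ι → F, MvPolynomial.C (∑ c : C, ψ (v ⬝ᵥ (c : ι → F))) * ∏ i, φ (v i) := by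
        simp only [sum_addChar_dotProduct C hψ, apply_ite MvPolynomial.C, map_zero, ite_mul,
          zero_mul]
        rw [weightEnumerator_eq_sum_prod, Finset.smul_sum, ← Finset.sum_filter,
          Finset.sum_subtype _ (p := fun v => v ∈ dualCode C) (by simp)]
        exact Finset.sum_congr rfl fun c _ => smul_eq_C_mul _ _
    _ = ∑ c : C, ∑ v : ι → F, ∏ i, (MvPolynomial.C (ψ (v i * (c : ι → F) i)) * φ (v i)) := by
        simp only [map_sum, Finset.sum_mul]
        rw [Finset.sum_comm]
        refine Finset.sum_congr rfl fun c _ => Finset.sum_congr rfl fun v _ => ?_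
        rw [Finset.prod_mul_distrib, ← map_prod, dotProduct, AddChar.map_sum_eq_prod]
    _ = ∑ c : C, ∏ i, linSubst !![1, (Fintype.card F : ℂ) - 1; 1, -1] (φ ((c : ι → F) i)) := by
        refine Finset.sum_congr rfl fun c _ => ?_
        have := Finset.prod_univ_sum (fun _ : ι => (Finset.univ : Finset F))
          (fun i t => MvPolynomial.C (ψ (t * (c : ι → F) i)) * φ t)
        rw [Fintype.piFinset_univ] at this
        rw [← this]
        exact Finset.prod_congr rfl fun i _ => htransform _
    _ = _ := by
        rw [weightEnumerator_eq_sum_prod, map_sum]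
        refine Finset.sum_congr rfl fun c _ => ?_
        rw [map_prod]

/-- The MacWilliams substitution has determinant `-q`, so it is invertible. -/
theorem hasTrivialStabilizer_weightEnumerator_dualCode {C : Submodule F (ι → F)}
    (h : HasTrivialStabilizer (weightEnumerator C)) :
    HasTrivialStabilizer (weightEnumerator (dualCode C)) := by
  classical
  have hC : (Fintype.card C : ℂ) ≠ 0 := Nat.cast_ne_zero.2 Fintype.card_ne_zero
  have hdet : (!![1, (Fintype.card F : ℂ) - 1; 1, -1]).det ≠ 0 := by
    rw [Matrix.det_fin_two_of]
    ring_nf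
    simp
  have := h.smul_linSubst (inv_ne_zero hC) (Matrix.GeneralLinearGroup.mkOfDetNeZero _ hdet)
  have hm := card_smul_weightEnumerator_dualCode C
  change HasTrivialStabilizer (_ • linSubst !![1, (Fintype.card F : ℂ) - 1; 1, -1] _) at this
  rwa [← hm, smul_smul, inv_mul_cancel₀ hC, one_smul] at this

end MacWilliams

/-! ### Dimensions of evaluation codes and duals of Reed-Muller codes -/

section Dimension

open MvPolynomial

variable {F : Type*} [Field F]

theorem finrank_dualCode_add {ι : Type*} [Fintype ι] (C : Submodule F (ι → F)) :
    Module.finrank F (dualCode C) + Module.finrank F C = Fintype.card ι := by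
  classical
  have hnd : (dotProductBilin F F : LinearMap.BilinForm F (ι → F)).Nondegenerate :=
    ⟨fun v hv => dotProduct_eq_zero v hv,
      fun v hv => dotProduct_eq_zero v fun w => by rw [dotProduct_comm]; exact hv w⟩
  have h := LinearMap.BilinForm.finrank_orthogonal hnd C
  have hle := Submodule.finrank_le C
  have heq : LinearMap.BilinForm.orthogonal (dotProductBilin F F) C = dualCode C := by
    ext v
    rw [LinearMap.BilinForm.mem_orthogonal_iff]
    refine forall₂_congr fun c _ => ?_
    rw [dotProduct_comm]
    rfl
  rw [Module.finrank_fintype_fun_eq_card] at h hle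
  rw [← heq, h]
  omega

theorem dualCode_eq_of_finrank {ι : Type*} [Fintype ι] {C D : Submodule F (ι → F)}
    (h : ∀ c ∈ C, ∀ d ∈ D, d ⬝ᵥ c = 0)
    (hfr : Module.finrank F C + Module.finrank F D = Fintype.card ι) : dualCode C = D := by
  have hle : D ≤ dualCode C := fun d hd c hc => h c hc d hd
  refine (Submodule.eq_of_le_of_finrank_eq hle ?_).symm
  have := finrank_dualCode_add C
  omega

theorem evalAt_apply {σ ι : Type*} (P : ι → σ → F) (p : MvPolynomial σ F) (i : ι) :
    evalAt P p i = eval (P i) p := by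
  rw [← aeval_eq_eval]
  rfl

theorem finrank_map_evalAt {σ ι : Type*} (P : ι → σ → F) (S : Set (σ →₀ ℕ))
    (h : ∀ p ∈ restrictSupport F S, (∀ i, eval (P i) p = 0) → p = 0) :
    Module.finrank F ((restrictSupport F S).map (evalAt P)) = Nat.card S := by
  have hinj : Function.Injective ((evalAt P).domRestrict (restrictSupport F S)) := by
    rw [← LinearMap.ker_eq_bot, LinearMap.ker_eq_bot']
    intro p hp
    refine Subtype.ext (h p p.2 fun i => ?_)
    rw [← evalAt_apply]
    exact congrFun hp i
  rw [← Module.finrank_eq_nat_card_basis (basisRestrictSupport F S)]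
  rw [← LinearMap.range_domRestrict]
  exact LinearMap.finrank_range_of_inj hinj

theorem eq_zero_of_forall_eval_eq_zero_of_totalDegree_lt [Fintype F] {σ : Type*} [Finite σ]
    {p : MvPolynomial σ F} (hd : p.totalDegree < Fintype.card F) (h : ∀ v, eval v p = 0) :
    p = 0 :=
  eq_zero_of_eval_zero_at_prod_finset p (fun _ => Finset.univ)
    (fun i => lt_of_le_of_lt (degreeOf_le_totalDegree p i) hd) fun v _ => h v

/-- A form of degree `q` that vanishes on all of `F ^ σ` is zero. -/
theorem eq_zero_of_forall_eval_eq_zero_of_isHomogeneous_card [Fintype F] {σ : Type*} [Fintype σ]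
    {p : MvPolynomial σ F} (hp : p.IsHomogeneous (Fintype.card F)) (h : ∀ v, eval v p = 0) :
    p = 0 := by
  classical
  set q := Fintype.card F with hq
  have hq1 : 1 < q := Fintype.one_lt_card
  -- The only monomials of degree `q` with an exponent at least `q` are the `x_i ^ q`. Replacing
  -- each by `x_i` keeps all values and leaves the reduced polynomial `p - r`, which must vanish.
  set c : σ → F := fun i => coeff (Finsupp.single i q) p with hc
  set r : MvPolynomial σ F := ∑ i, C (c i) * (X i ^ q - X i) with hr
  have hcoeff : ∀ m, coeff m r = ∑ i, c i * ((if Finsupp.single i q = m then 1 else 0) -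
      if Finsupp.single i 1 = m then 1 else 0) := by
    intro m
    rw [hr, coeff_sum]
    refine Finset.sum_congr rfl fun i _ => ?_
    rw [coeff_C_mul, coeff_sub, coeff_X_pow, coeff_X]
  have hpr : p - r = 0 := by
    refine eq_zero_of_eval_zero_at_prod_finset _ (fun _ => Finset.univ) (fun i => ?_) fun v _ => ?_
    · rw [Finset.card_univ, degreeOf_lt_iff (by omega)]
      intro m hm
      by_contra! hmi
      rw [mem_support_iff, coeff_sub] at hm
      have hr' : coeff m r = if Finsupp.single i q = m then c i else 0 := by
        rw [hcoeff, Finset.sum_eq_single i]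
        · rw [if_neg (c := Finsupp.single i 1 = m)]
          · simp
          · rintro rfl
            simp at hmi
            omega
        · intro j _ hj
          rw [if_neg, if_neg, sub_zero, mul_zero]
          · rintro rfl
            simp [hj] at hmi
          · rintro rfl
            simp [hj] at hmi
        · simp
      split_ifs at hr' with hs
      · rw [hr', ← hs] at hm
        simp [hc] at hm
      · rw [hr', sub_zero] at hm
        have hdeg : Finsupp.degree m = q := by
          by_contra hne
          exact hm (hp.coeff_eq_zero hne)
        rw [Finsupp.degree_eq_sum, ← Finset.add_sum_erase _ _ (Finset.mem_univ i)] at hdeg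
        have hmi' : m i = q := by omega
        have hsum : ∑ j ∈ Finset.univ.erase i, m j = 0 := by omega
        rw [Finset.sum_eq_zero_iff] at hsum
        refine hs (Finsupp.ext fun j => ?_)
        by_cases hj : j = i
        · simp [hj, hmi']
        · simp [Ne.symm hj, hsum j (Finset.mem_erase.2 ⟨hj, Finset.mem_univ j⟩)]
    · simp [hr, h v, hq, FiniteField.pow_card]
  rw [sub_eq_zero] at hpr
  -- The linear coefficients of `r` are the `-c i`, while `p` has none because `q > 1`.
  have hci : ∀ i, c i = 0 := by
    intro i
    have h1 : coeff (Finsupp.single i 1) p = 0 := by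
      refine hp.coeff_eq_zero ?_
      rw [Finsupp.degree_single]
      omega
    rw [hpr, hcoeff, Finset.sum_eq_single i] at h1
    · rw [if_neg, if_pos rfl] at h1
      · simpa using h1
      · intro h
        have := DFunLike.congr_fun h i
        simp at this
        omega
    · intro j _ hj
      rw [if_neg, if_neg, sub_zero, mul_zero]
      · intro h
        have := DFunLike.congr_fun h j
        simp [hj.symm] at this
      · intro h
        have := DFunLike.congr_fun h j
        simp [hj.symm] at this
        omega
    · simp
  rw [hpr, hr]
  simp [hci]

theorem MvPolynomial.IsHomogeneous.eval_smul {σ : Type*} [Fintype σ] {p : MvPolynomial σ F} {n : ℕ}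
    (hp : p.IsHomogeneous n) (a : F) (v : σ → F) : eval (a • v) p = a ^ n * eval v p := by
  rw [eval_eq', eval_eq', Finset.mul_sum]
  refine Finset.sum_congr rfl fun d hd => ?_
  have hdeg : Finsupp.degree d = n := by
    by_contra hne
    exact (mem_support_iff.1 hd) (hp.coeff_eq_zero hne)
  simp only [Pi.smul_apply, smul_eq_mul, mul_pow, Finset.prod_mul_distrib]
  rw [Finset.prod_pow_eq_pow_sum, ← Finsupp.degree_eq_sum, hdeg]
  ring

theorem natCard_degree_eq (m n : ℕ) :
    Nat.card {d : Fin m →₀ ℕ | Finsupp.degree d = n} = m.multichoose n := by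
  have h : {d : Fin m →₀ ℕ | Finsupp.degree d = n} =
      ((Finset.univ.finsuppAntidiag n : Finset (Fin m →₀ ℕ)) : Set (Fin m →₀ ℕ)) := by
    ext d
    simp [Finset.mem_finsuppAntidiag, Finsupp.degree_eq_sum]
  rw [h]
  simp only [Finset.coe_sort_coe, Nat.card_eq_fintype_card, Fintype.card_coe]
  simp [Finset.card_finsuppAntidiag_nat_eq_multichoose]

theorem natCard_degree_le (m n : ℕ) :
    Nat.card {d : Fin m →₀ ℕ | (d.sum fun _ e => e) ≤ n} =
      ∑ i ∈ Finset.range (n + 1), m.multichoose i := by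
  have h : {d : Fin m →₀ ℕ | (d.sum fun _ e => e) ≤ n} =
      (((Finset.range (n + 1)).biUnion fun i => Finset.univ.finsuppAntidiag i :
        Finset (Fin m →₀ ℕ)) : Set (Fin m →₀ ℕ)) := by
    ext d
    simp [Finset.mem_finsuppAntidiag, Finsupp.sum_fintype]
  rw [h]
  simp only [Finset.coe_sort_coe, Nat.card_eq_fintype_card, Fintype.card_coe]
  rw [Finset.card_biUnion]
  · simp [Finset.card_finsuppAntidiag_nat_eq_multichoose]
  · intro i _ j _ hij
    rw [Function.onFun, Finset.disjoint_left]
    intro d hd hd'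
    rw [Finset.mem_finsuppAntidiag] at hd hd'
    exact hij (hd.1.symm.trans hd'.1)

theorem finrank_reedMuller [Fintype F] {r : ℕ} (m : ℕ) (hr : r < Fintype.card F) :
    Module.finrank F (reedMuller F r m) = ∑ i ∈ Finset.range (r + 1), m.multichoose i := by
  rw [← natCard_degree_le]
  refine finrank_map_evalAt _ _ fun p hp h =>
    eq_zero_of_forall_eval_eq_zero_of_totalDegree_lt (lt_of_le_of_lt ?_ hr) h
  exact (mem_restrictTotalDegree _ _ _).1 hp

/-- Products of codewords are values of polynomials of degree below `(q - 1) m`, whose sum over `F ^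
m` vanishes; `hcard` says that the dimensions are complementary. -/
theorem dualCode_reedMuller [Fintype F] {r s m : ℕ} (hrs : r + s < (Fintype.card F - 1) * m)
    (hr : r < Fintype.card F) (hs : s < Fintype.card F)
    (hcard : ∑ i ∈ Finset.range (r + 1), m.multichoose i +
      ∑ i ∈ Finset.range (s + 1), m.multichoose i = Fintype.card F ^ m) :
    dualCode (reedMuller F r m) = reedMuller F s m := by
  classical
  refine dualCode_eq_of_finrank ?_ ?_
  · rintro _ ⟨p, hp, rfl⟩ _ ⟨p', hp', rfl⟩
    have hp := (mem_restrictTotalDegree _ _ _).1 hp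
    have hp' := (mem_restrictTotalDegree _ _ _).1 hp'
    have h := sum_eval_eq_zero (p' * p) (lt_of_le_of_lt (totalDegree_mul _ _) (by
      rw [Fintype.card_fin]
      omega))
    rw [← h]
    refine Finset.sum_congr rfl fun v _ => ?_
    rw [evalAt_apply, evalAt_apply, map_mul]
  · rw [finrank_reedMuller m hr, finrank_reedMuller m hs, hcard]
    simp

end Dimension

/-! ### Projective Reed-Muller codes and their duals -/

section Projective

open MvPolynomial

variable {F : Type*} [Field F] {m : ℕ} {R : Finset (Fin (m + 1) → F)}

theorem IsProjectiveRepresentatives.bijective_smul (hR : IsProjectiveRepresentatives R) :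
    Function.Bijective fun x : Fˣ × R =>
      (⟨(x.1 : F) • (x.2 : Fin (m + 1) → F),
        smul_ne_zero x.1.ne_zero (hR.choose x.2)⟩ : {v : Fin (m + 1) → F // v ≠ 0}) := by
  obtain ⟨h, hinj, hsurj⟩ := hR
  constructor
  · rintro ⟨a, v⟩ ⟨b, w⟩ hab
    have hab : (a : F) • (v : Fin (m + 1) → F) = (b : F) • (w : Fin (m + 1) → F) :=
      congrArg Subtype.val hab
    have hvw : v = w := by
      refine hinj ((Projectivization.mk_eq_mk_iff' F _ _ _ _).2 ⟨(a : F)⁻¹ * b, ?_⟩)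
      rw [mul_smul, ← hab, inv_smul_smul₀ a.ne_zero]
    subst hvw
    rw [Prod.mk.injEq]
    exact ⟨Units.ext (smul_left_injective F (h v) hab), rfl⟩
  · rintro ⟨v, hv⟩
    obtain ⟨w, hw⟩ := hsurj (Projectivization.mk F v hv)
    obtain ⟨a, ha⟩ := (Projectivization.mk_eq_mk_iff F _ _ _ _).1 hw.symm
    exact ⟨(a, w), Subtype.ext ha⟩

/-- A sum over the nonzero vectors, grouped by the points of the projective space. -/
theorem IsProjectiveRepresentatives.sum_ne_zero [Fintype F] [DecidableEq F] {M : Type*}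
    [AddCommMonoid M] (hR : IsProjectiveRepresentatives R) (f : (Fin (m + 1) → F) → M) :
    ∑ v ∈ Finset.univ.erase 0, f v = ∑ v : R, ∑ a : Fˣ, f ((a : F) • (v : Fin (m + 1) → F)) := by
  rw [Finset.sum_subtype (p := fun v => v ≠ 0) _ (by simp), Finset.sum_comm,
    ← Fintype.sum_prod_type' (f := fun (a : Fˣ) (v : R) => f ((a : F) • (v : Fin (m + 1) → F)))]
  exact (Function.Bijective.sum_comp hR.bijective_smul
    (fun v : {v : Fin (m + 1) → F // v ≠ 0} => f v)).symm

theorem IsProjectiveRepresentatives.card_mul [Fintype F] (hR : IsProjectiveRepresentatives R) :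
    R.card * (Fintype.card F - 1) = Fintype.card F ^ (m + 1) - 1 := by
  classical
  have h := hR.sum_ne_zero (fun _ => (1 : ℕ))
  simpa [Fintype.card_units, Finset.card_erase_of_mem] using h.symm

/-- A form vanishing on `R` vanishes everywhere by homogeneity. The degree `r = q`, needed for
`PRM_5(5,2)`, is not covered by the degree bound and is treated separately. -/
theorem finrank_projReedMuller [Fintype F] (hR : IsProjectiveRepresentatives R) {r : ℕ}
    (hr0 : r ≠ 0) (hr : r ≤ Fintype.card F) :
    Module.finrank F (projReedMuller r m R) = (m + 1).multichoose r := by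
  rw [← natCard_degree_eq, projReedMuller, homogeneousSubmodule_eq_finsupp_supported]
  refine finrank_map_evalAt _ _ fun p hp h => ?_
  have hp : p.IsHomogeneous r := by
    rw [← mem_homogeneousSubmodule, homogeneousSubmodule_eq_finsupp_supported]
    exact hp
  have h0 : ∀ v, eval v p = 0 := by
    intro v
    by_cases hv : v = 0
    · have := hp.eval_smul 0 v
      rwa [zero_pow hr0, zero_mul, zero_smul, ← hv] at this
    · obtain ⟨⟨a, w⟩, haw⟩ := hR.bijective_smul.2 ⟨v, hv⟩
      have haw : (a : F) • (w : Fin (m + 1) → F) = v := congrArg Subtype.val haw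
      rw [← haw, hp.eval_smul, h w, mul_zero]
  rcases hr.lt_or_eq with hlt | rfl
  · exact eq_zero_of_forall_eval_eq_zero_of_totalDegree_lt
      (lt_of_le_of_lt hp.totalDegree_le hlt) h0
  · exact eq_zero_of_forall_eval_eq_zero_of_isHomogeneous_card hp h0

/-- As `q - 1` divides `r + s`, the product of two forms is constant on scalar classes of nonzero
vectors. So its vanishing sum over the whole space is `q - 1`, a unit of `F`, times its sum over
`R`. -/
theorem dualCode_projReedMuller [Fintype F] (hR : IsProjectiveRepresentatives R) {r s : ℕ}
    (hr0 : r ≠ 0) (hs0 : s ≠ 0) (hr : r ≤ Fintype.card F) (hs : s ≤ Fintype.card F)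
    (hrs : r + s < (Fintype.card F - 1) * (m + 1)) (hdvd : Fintype.card F - 1 ∣ r + s)
    (hcard : (m + 1).multichoose r + (m + 1).multichoose s = R.card) :
    dualCode (projReedMuller r m R) = projReedMuller s m R := by
  classical
  refine dualCode_eq_of_finrank ?_ ?_
  · rintro _ ⟨p, hp, rfl⟩ _ ⟨p', hp', rfl⟩
    have hpp : (p' * p).IsHomogeneous (s + r) := IsHomogeneous.mul hp' hp
    have h := sum_eval_eq_zero (p' * p) (lt_of_le_of_lt hpp.totalDegree_le (by
      rw [Fintype.card_fin]
      omega))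
    have h0 : eval 0 (p' * p) = 0 := by
      have := hpp.eval_smul 0 0
      rwa [zero_pow (by omega), zero_mul, zero_smul] at this
    rw [← Finset.add_sum_erase _ _ (Finset.mem_univ 0), h0, zero_add, hR.sum_ne_zero] at h
    have hpow : ∀ a : Fˣ, (a : F) ^ (s + r) = 1 := by
      intro a
      obtain ⟨k, hk⟩ := hdvd
      rw [add_comm, hk, pow_mul, FiniteField.pow_card_sub_one_eq_one _ a.ne_zero, one_pow]
    simp only [hpp.eval_smul, hpow, one_mul, Finset.sum_const, Finset.card_univ,
      Fintype.card_units, nsmul_eq_mul, ← Finset.mul_sum] at h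
    have hq : ((Fintype.card F - 1 : ℕ) : F) ≠ 0 := by
      rw [Nat.cast_sub Fintype.card_pos, FiniteField.cast_card_eq_zero]
      simp
    rw [← (mul_eq_zero.1 h).resolve_left hq]
    refine Finset.sum_congr rfl fun v _ => ?_
    rw [evalAt_apply, evalAt_apply, map_mul]
  · rw [finrank_projReedMuller hR hr0 hr, finrank_projReedMuller hR hs0 hs, hcard]
    simp

end Projective

/-! ### Explicit parametrizations of evaluation codes -/

section Parametrization

open MvPolynomial

variable {F : Type*} [Field F]

theorem injective_and_range_eq {V W : Type*} [AddCommGroup V] [Module F V] [AddCommGroup W]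
    [Module F W] [FiniteDimensional F V] {C : Submodule F W} {Φ : V →ₗ[F] W}
    (hle : C ≤ LinearMap.range Φ) (h : Module.finrank F C = Module.finrank F V) :
    Function.Injective Φ ∧ LinearMap.range Φ = C := by
  have h1 := Submodule.finrank_mono hle
  have h2 := LinearMap.finrank_range_le Φ
  have hr : Module.finrank F (LinearMap.range Φ) = Module.finrank F V := by omega
  refine ⟨?_, (Submodule.eq_of_le_of_finrank_eq hle (by omega)).symm⟩
  have h3 := LinearMap.finrank_range_add_finrank_ker Φ
  have h4 : Module.finrank F (LinearMap.ker Φ) = 0 := by omega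
  rw [← LinearMap.ker_eq_bot]
  exact Submodule.finrank_eq_zero.1 h4

theorem map_evalAt_le {σ κ : Type*} [Fintype σ] {P : κ → σ → F} {S : Set (σ →₀ ℕ)}
    {Q : Submodule F (κ → F)} (h : ∀ d ∈ S, (fun i => ∏ j, P i j ^ d j) ∈ Q) :
    (restrictSupport F S).map (evalAt P) ≤ Q := by
  rintro _ ⟨p, hp, rfl⟩
  have : evalAt P p = ∑ d ∈ p.support, coeff d p • fun i => ∏ j, P i j ^ d j := by
    ext i
    rw [evalAt_apply, eval_eq', Finset.sum_apply]
    rfl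
  rw [this]
  exact Submodule.sum_mem _ fun d hd => Submodule.smul_mem _ _ (h d (hp hd))

end Parametrization

/-! ### Counting words by weight -/

section Counting

open MvPolynomial

theorem ofDigits_eq_sum_range (b : ℕ) (L : List ℕ) :
    Nat.ofDigits b L = ∑ i ∈ Finset.range L.length, L.getD i 0 * b ^ i := by
  induction L with
  | nil => simp
  | cons a L ih =>
    rw [Nat.ofDigits_cons, List.length_cons, Finset.sum_range_succ', ih, Finset.mul_sum, add_comm]
    congr 1
    · refine Finset.sum_congr rfl fun i _ => ?_
      rw [List.getD_cons_succ, pow_succ]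
      ring
    · simp

/-- A statistic on a finite type is equidistributed with the digits of its generating function
evaluated at a large number. -/
theorem card_filter_eq_of_sum_pow_eq_ofDigits {T : Type*} [Fintype T] {f : T → ℕ} {b : ℕ}
    {L : List ℕ} (hb : 1 < b) (hT : Fintype.card T < b) (hf : ∀ t, f t < L.length)
    (hL : ∀ l ∈ L, l < b) (h : ∑ t, b ^ f t = Nat.ofDigits b L) (w : ℕ) :
    (Finset.univ.filter fun t => f t = w).card = L.getD w 0 := by
  set L' := (List.range L.length).map fun w => (Finset.univ.filter fun t => f t = w).card with hL'
  have hlen : L'.length = L.length := by simp [hL']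
  have hget : ∀ w < L.length, L'.getD w 0 = (Finset.univ.filter fun t => f t = w).card := by
    intro w hw
    rw [List.getD_eq_getElem _ _ (by omega)]
    simp [hL']
  -- Every count is at most `Fintype.card T < b`, so no carries occur and the base `b` digits are
  -- unique.
  have heq : L' = L := by
    refine Nat.ofDigits_inj_of_len_eq hb hlen ?_ hL ?_
    · intro l hl
      rw [hL', List.mem_map] at hl
      obtain ⟨w, -, rfl⟩ := hl
      exact lt_of_le_of_lt (Finset.card_le_univ _) hT
    · rw [← h, ofDigits_eq_sum_range, hlen,
        ← Finset.sum_fiberwise_of_maps_to (s := Finset.univ) (t := Finset.range L.length) (g := f)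
          (fun t _ => Finset.mem_range.2 (hf t))]
      refine Finset.sum_congr rfl fun w hw => ?_
      rw [hget w (Finset.mem_range.1 hw), Finset.sum_congr rfl (g := fun _ => b ^ w),
        Finset.sum_const, smul_eq_mul]
      intro t ht
      rw [(Finset.mem_filter.1 ht).2]
  by_cases hw : w < L.length
  · rw [← hget w hw, heq]
  · rw [List.getD_eq_default _ _ (by omega), Finset.card_eq_zero, Finset.filter_eq_empty_iff]
    intro t _ ht
    exact hw (ht ▸ hf t)

variable {F : Type*} [Field F] [Fintype F] {ι : Type*} [Fintype ι]

open Classical in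
/-- The number of codewords of weight `w`. -/
noncomputable def weightCount (C : Submodule F (ι → F)) (w : ℕ) : ℕ :=
  (Finset.univ.filter fun c : C => hammingNorm (c : ι → F) = w).card

open Classical in
/-- The number of codewords of weight `w` with entry `1` at the coordinate `i`. -/
noncomputable def weightCountAt (C : Submodule F (ι → F)) (i : ι) (w : ℕ) : ℕ :=
  (Finset.univ.filter fun c : C => hammingNorm (c : ι → F) = w ∧ (c : ι → F) i = 1).card

theorem weightEnumerator_eq_weightForm {C : Submodule F (ι → F)} {L : List ℕ}
    (hlen : L.length = Fintype.card ι + 1)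
    (h : ∀ w < L.length, weightCount C w = L.getD w 0) :
    weightEnumerator C = weightForm L := by
  classical
  rw [weightEnumerator, weightForm,
    ← Finset.sum_fiberwise_of_maps_to (s := Finset.univ) (t := Finset.range L.length)
      (g := fun c : C => hammingNorm (c : ι → F))
      (fun c _ => Finset.mem_range.2 (by
        rw [hlen]
        exact Nat.lt_succ_of_le hammingNorm_le_card_fintype))]
  refine Finset.sum_congr rfl fun w hw => ?_
  rw [← h w (Finset.mem_range.1 hw), hlen, Nat.add_sub_cancel]
  rw [Finset.sum_congr rfl (g := fun _ => X 0 ^ (Fintype.card ι - w) * X 1 ^ w), Finset.sum_const,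
    nsmul_eq_mul, weightCount]
  · simp
  · intro c hc
    rw [← (Finset.mem_filter.1 hc).2]

theorem weightCount_zero (C : Submodule F (ι → F)) : weightCount C 0 = 1 := by
  classical
  rw [weightCount, Finset.card_eq_one]
  refine ⟨0, ?_⟩
  ext c
  simp

/-- In a code with a permutation group that is transitive on the coordinates in `J`, the number of
words of given weight is found from the number of those with a `1` at one coordinate. -/
theorem mul_weightCount {C : Submodule F (ι → F)} {J : Finset ι} {i₀ : ι}
    (hJ : ∀ c ∈ C, ∀ i ∉ J, c i = 0)
    (hσ : ∀ j ∈ J, ∃ σ : Equiv.Perm ι, σ i₀ = j ∧ ∀ c ∈ C, c ∘ σ ∈ C) (w : ℕ) :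
    w * weightCount C w = J.card * (Fintype.card F - 1) * weightCountAt C i₀ w := by
  classical
  have hnorm : ∀ c ∈ C, hammingNorm c = ∑ j ∈ J, if c j ≠ 0 then 1 else 0 := by
    intro c hc
    rw [hammingNorm, Finset.card_filter]
    refine (Finset.sum_subset (Finset.subset_univ J) fun j _ hj => ?_).symm
    simp [hJ c hc j hj]
  -- Composition with `σ` moves the entry at `j` to `i₀` and division by `a` makes it `1`; both
  -- preserve the weight.
  have hfib : ∀ j ∈ J, ∀ a : Fˣ,
      (Finset.univ.filter fun c : C => hammingNorm (c : ι → F) = w ∧ (c : ι → F) j = a).card =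
      (Finset.univ.filter fun c : C => hammingNorm (c : ι → F) = w ∧ (c : ι → F) i₀ = 1).card := by
    intro j hj a
    obtain ⟨σ, hσj, hσC⟩ := hσ j hj
    have hinj : Function.Injective fun c : C => (⟨(c : ι → F) ∘ σ, hσC c c.2⟩ : C) := by
      intro c d hcd
      refine Subtype.ext (funext fun i => ?_)
      have := congrFun (congrArg Subtype.val hcd) (σ.symm i)
      simpa using this
    have hbij : Function.Bijective fun c : C =>
        ((a⁻¹ : Fˣ) : F) • (⟨(c : ι → F) ∘ σ, hσC c c.2⟩ : C) := by
      refine Finite.injective_iff_bijective.1 fun c d hcd => hinj ?_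
      exact smul_right_injective C (a⁻¹ : Fˣ).ne_zero hcd
    refine Finset.card_bijective _ hbij fun c => ?_
    have h1 : hammingNorm (((a⁻¹ : Fˣ) : F) • ((c : ι → F) ∘ σ)) = hammingNorm (c : ι → F) := by
      rw [hammingNorm_smul (fun _ => (IsSMulRegular.of_ne_zero (a⁻¹ : Fˣ).ne_zero))]
      rw [hammingNorm, hammingNorm, Finset.card_filter, Finset.card_filter]
      exact Equiv.sum_comp σ fun i => if (c : ι → F) i ≠ 0 then 1 else 0
    simp only [Finset.mem_filter, Finset.mem_univ, true_and, Submodule.coe_smul, h1, Pi.smul_apply,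
      Function.comp_apply, hσj, smul_eq_mul]
    rw [Units.inv_mul_eq_one]
    exact and_congr_right fun _ => eq_comm
  -- Double counting of pairs of a word of weight `w` and a coordinate in its support.
  calc w * weightCount C w
      = ∑ c ∈ Finset.univ.filter (fun c : C => hammingNorm (c : ι → F) = w),
          hammingNorm (c : ι → F) := by
        rw [Finset.sum_congr rfl fun c hc => (Finset.mem_filter.1 hc).2, Finset.sum_const,
          smul_eq_mul, mul_comm, weightCount]
    _ = ∑ c ∈ Finset.univ.filter (fun c : C => hammingNorm (c : ι → F) = w),
          ∑ j ∈ J, ∑ a : Fˣ, if (c : ι → F) j = a then 1 else 0 := by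
        refine Finset.sum_congr rfl fun c _ => ?_
        rw [hnorm c c.2]
        refine Finset.sum_congr rfl fun j _ => ?_
        split_ifs with h
        · rw [Finset.sum_eq_single (Units.mk0 _ h)]
          · simp
          · intro a _ ha
            rw [if_neg]
            exact fun h' => ha (Units.ext h'.symm)
          · simp
        · refine (Finset.sum_eq_zero fun a _ => ?_).symm
          rw [not_not] at h
          rw [if_neg]
          exact fun h' => a.ne_zero (h'.symm.trans h)
    _ = ∑ j ∈ J, ∑ a : Fˣ, (Finset.univ.filter fun c : C =>
          hammingNorm (c : ι → F) = w ∧ (c : ι → F) j = a).card := by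
        rw [Finset.sum_comm]
        refine Finset.sum_congr rfl fun j _ => ?_
        rw [Finset.sum_comm]
        refine Finset.sum_congr rfl fun a _ => ?_
        rw [← Finset.card_filter, Finset.filter_filter]
    _ = _ := by
        rw [Finset.sum_congr rfl fun j hj => Finset.sum_congr rfl fun a _ => hfib j hj a]
        simp [Fintype.card_units, mul_assoc, weightCountAt]

/-- The sum `∑ i < n, f i`, in a form that is evaluated efficiently. -/
def natSum (n : ℕ) (f : ℕ → ℕ) : ℕ := Nat.rec 0 (fun i s => Nat.add s (f i)) n

theorem natSum_eq_sum (n : ℕ) (f : ℕ → ℕ) : natSum n f = ∑ i ∈ Finset.range n, f i := by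
  induction n with
  | zero => rfl
  | succ n ih =>
    rw [Finset.sum_range_succ, ← ih]
    rfl

theorem sum_vecCons {α M : Type*} [Fintype α] [AddCommMonoid M] {k : ℕ} (g : (Fin (k + 1) → α) → M) :
    ∑ a, g a = ∑ x : α, ∑ a : Fin k → α, g (Matrix.vecCons x a) := by
  rw [← Fintype.sum_prod_type']
  exact (Fintype.sum_equiv (Fin.consEquiv fun _ => α) _ _ fun _ => rfl).symm

end Counting

theorem sum_fin_five {α M : Type*} [AddCommMonoid M] [Fintype α] (g : (Fin 5 → α) → M) :
    ∑ a, g a = ∑ a₁ : α, ∑ a₂ : α, ∑ a₃ : α, ∑ a₄ : α, ∑ a₅ : α, g ![a₁, a₂, a₃, a₄, a₅] := by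
  simp only [sum_vecCons, Finset.univ_unique, Finset.sum_singleton]
  rfl

/-! ### The code of affine conics -/

section AffineConics

open MvPolynomial

variable {F : Type*} [Field F]

open Classical in
-- The entry at `i₀` is the leading parameter, so fixing it to `1` leaves the other `k` parameters
-- free.
theorem weightCountAt_eq_card [Fintype F] {ι : Type*} [Fintype ι] {C : Submodule F (ι → F)}
    {k : ℕ} {Φ : (Fin (k + 1) → F) →ₗ[F] (ι → F)} (hinj : Function.Injective Φ)
    (hrange : LinearMap.range Φ = C) {i₀ : ι} (h₀ : ∀ a, Φ a i₀ = a 0) (w : ℕ) :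
    weightCountAt C i₀ w =
      (Finset.univ.filter fun a : Fin k → F => hammingNorm (Φ (Matrix.vecCons 1 a)) = w).card := by
  symm
  refine Finset.card_bij (fun a _ => ⟨Φ (Matrix.vecCons 1 a), hrange ▸ ⟨_, rfl⟩⟩) ?_ ?_ ?_
  · intro a ha
    simpa [h₀] using ha
  · intro a _ b _ hab
    exact (Matrix.vecCons_inj.1 (hinj (congrArg Subtype.val hab))).2
  · rintro ⟨c, hc⟩ hcw
    obtain ⟨a, rfl⟩ := hrange ▸ hc
    simp only [Finset.mem_filter, Finset.mem_univ, true_and, h₀] at hcw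
    have ha : Matrix.vecCons 1 (Matrix.vecTail a) = a := by
      rw [← hcw.2]
      exact Matrix.cons_head_tail a
    exact ⟨Matrix.vecTail a, by simpa [ha] using hcw.1, by simp [ha]⟩

/-- The function on the affine plane that is given by a polynomial of degree at most two. -/
def affineConic (F : Type*) [Field F] : (Fin 6 → F) →ₗ[F] ((Fin 2 → F) → F) where
  toFun a v := a 0 + a 1 * v 0 + a 2 * v 1 + a 3 * v 0 ^ 2 + a 4 * (v 0 * v 1) + a 5 * v 1 ^ 2
  map_add' a b := by
    ext v
    simp only [Pi.add_apply]
    ring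
  map_smul' c a := by
    ext v
    simp only [Pi.smul_apply, smul_eq_mul, RingHom.id_apply]
    ring

theorem affineConic_apply (a : Fin 6 → F) (v : Fin 2 → F) : affineConic F a v =
    a 0 + a 1 * v 0 + a 2 * v 1 + a 3 * v 0 ^ 2 + a 4 * (v 0 * v 1) + a 5 * v 1 ^ 2 := rfl

theorem reedMuller_two_two_le : reedMuller F 2 2 ≤ LinearMap.range (affineConic F) := by
  refine map_evalAt_le fun d hd => ?_
  have hd' : d 0 + d 1 ≤ 2 := by
    have : (d.sum fun _ e => e) ≤ 2 := hd
    rwa [Finsupp.sum_fintype _ _ (fun _ => rfl), Fin.sum_univ_two] at this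
  have key : ∀ i j : ℕ, i + j ≤ 2 →
      (fun v : Fin 2 → F => v 0 ^ i * v 1 ^ j) ∈ LinearMap.range (affineConic F) := by
    intro i j hij
    have hi : i ≤ 2 := by omega
    have hj : j ≤ 2 := by omega
    interval_cases i <;> interval_cases j <;> first | omega | skip
    · exact ⟨![1, 0, 0, 0, 0, 0], by ext v; simp [affineConic_apply]⟩
    · exact ⟨![0, 0, 1, 0, 0, 0], by ext v; simp [affineConic_apply]⟩
    · exact ⟨![0, 0, 0, 0, 0, 1], by ext v; simp [affineConic_apply]⟩
    · exact ⟨![0, 1, 0, 0, 0, 0], by ext v; simp [affineConic_apply]⟩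
    · exact ⟨![0, 0, 0, 0, 1, 0], by ext v; simp [affineConic_apply]⟩
    · exact ⟨![0, 0, 0, 1, 0, 0], by ext v; simp [affineConic_apply]⟩
  simpa [Fin.prod_univ_two] using key (d 0) (d 1) hd'

open Classical in
theorem mul_weightCount_reedMuller_two_two [Fintype F] (hq : 2 < Fintype.card F) (w : ℕ) :
    w * weightCount (reedMuller F 2 2) w = Fintype.card F ^ 2 * (Fintype.card F - 1) *
      (Finset.univ.filter fun a : Fin 5 → F =>
        hammingNorm (affineConic F (Matrix.vecCons 1 a)) = w).card := by
  obtain ⟨hinj, hrange⟩ := injective_and_range_eq (reedMuller_two_two_le (F := F)) (by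
    rw [finrank_reedMuller 2 hq]
    simp [Finset.sum_range_succ, Nat.multichoose_eq])
  rw [mul_weightCount (J := Finset.univ) (i₀ := 0) (by simp),
    weightCountAt_eq_card hinj hrange (by simp [affineConic_apply])]
  · simp
  · intro u _
    refine ⟨Equiv.addRight u, by simp, fun c hc => ?_⟩
    obtain ⟨a, rfl⟩ := hrange ▸ hc
    rw [← hrange]
    -- The coefficients of the translate `f(v + u)`; translations are transitive on the plane.
    refine ⟨![affineConic F a u, a 1 + 2 * a 3 * u 0 + a 4 * u 1,
      a 2 + a 4 * u 0 + 2 * a 5 * u 1, a 3, a 4, a 5], ?_⟩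
    ext v
    simp [affineConic_apply]
    ring

open Classical in
theorem hammingNorm_affineConic [Fintype F] (a₁ a₂ a₃ a₄ a₅ : F) :
    hammingNorm (affineConic F ![1, a₁, a₂, a₃, a₄, a₅]) = ∑ x : F, ∑ y : F,
      if 1 + a₁ * x + a₂ * y + a₃ * x ^ 2 + a₄ * (x * y) + a₅ * y ^ 2 ≠ 0 then 1 else 0 := by
  rw [hammingNorm, Finset.card_filter, sum_vecCons]
  simp only [sum_vecCons, Finset.univ_unique, Finset.sum_singleton]
  rfl

open Classical in
/-- The weight enumerator of the code of affine conics, from the generating function of the weights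
of the conics that do not contain the origin. -/
theorem weightEnumerator_reedMuller_two_two [Fintype F] (hq : 2 < Fintype.card F) {b : ℕ}
    {L B : List ℕ} (hL : L.length = Fintype.card F ^ 2 + 1) (hB : B.length = Fintype.card F ^ 2 + 1)
    (h0 : L.getD 0 0 = 1)
    (hLB : ∀ w < L.length, w * L.getD w 0 =
      Fintype.card F ^ 2 * (Fintype.card F - 1) * B.getD w 0)
    (hb : Fintype.card F ^ 5 < b) (hBb : ∀ l ∈ B, l < b)
    (h : ∑ a₁ : F, ∑ a₂ : F, ∑ a₃ : F, ∑ a₄ : F, ∑ a₅ : F, b ^ (∑ x : F, ∑ y : F,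
      if 1 + a₁ * x + a₂ * y + a₃ * x ^ 2 + a₄ * (x * y) + a₅ * y ^ 2 ≠ 0 then 1 else 0) =
      Nat.ofDigits b B) :
    weightEnumerator (reedMuller F 2 2) = weightForm L := by
  refine weightEnumerator_eq_weightForm (by simpa using hL) fun w hw => ?_
  rcases Nat.eq_zero_or_pos w with rfl | hw0
  · rw [weightCount_zero, h0]
  · refine Nat.eq_of_mul_eq_mul_left hw0 ?_
    rw [mul_weightCount_reedMuller_two_two hq, hLB w hw]
    congr 1
    refine card_filter_eq_of_sum_pow_eq_ofDigits (b := b) ?_ (by simpa using hb) (fun a => ?_) hBb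
      ?_ w
    · have : 0 < Fintype.card F ^ 5 := by positivity
      omega
    · rw [hB]
      refine Nat.lt_succ_of_le (hammingNorm_le_card_fintype.trans ?_)
      simp
    · rw [sum_fin_five, ← h]
      simp only [← hammingNorm_affineConic]

end AffineConics

/-! ### Affine conics over the field with five elements -/

section FiveElements

variable {F : Type*} [Field F] [Fintype F]

theorem charP_of_card_eq_five (hF : Fintype.card F = 5) : CharP F 5 :=
  have : Fact (Nat.Prime 5) := ⟨by norm_num⟩
  charP_of_card_eq_prime hF

theorem sum_eq_sum_range_five (hF : Fintype.card F = 5) {M : Type*} [AddCommMonoid M] (g : F → M) :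
    ∑ x, g x = ∑ i ∈ Finset.range 5, g i := by
  have := charP_of_card_eq_five hF
  rw [← Fin.sum_univ_eq_sum_range (fun i => g i)]
  symm
  refine Function.Bijective.sum_comp (e := fun i : Fin 5 => ((i : ℕ) : F)) ?_ g
  rw [Fintype.bijective_iff_injective_and_card]
  refine ⟨fun i j hij => ?_, by simp [hF]⟩
  rw [CharP.natCast_eq_natCast (R := F) (p := 5)] at hij
  exact Fin.ext (Nat.ModEq.eq_of_lt_of_lt hij i.2 j.2)

open Classical in
-- Truncated subtraction makes `1 - (1 - k)` the indicator of `k ≠ 0`, in a form cheap for the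
-- kernel.
theorem ite_natCast_ne_zero_of_card_eq_five (hF : Fintype.card F = 5) (n : ℕ) :
    (if (n : F) ≠ 0 then 1 else 0) = Nat.sub 1 (Nat.sub 1 (Nat.mod n 5)) := by
  have := charP_of_card_eq_five hF
  have h5 := CharP.cast_eq_zero_iff F 5 n
  change _ = 1 - (1 - n % 5)
  split_ifs with h
  · rw [ne_eq, h5] at h
    omega
  · rw [not_not, h5] at h
    omega

/-- The generating function of the weights of the conics `f` with `f(0, 0) = 1` in the affine plane
over the field with five elements, evaluated at `2 ^ 14`. -/
def affineConicSumFive : ℕ :=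
  natSum 5 fun a₁ => natSum 5 fun a₂ => natSum 5 fun a₃ => natSum 5 fun a₄ => natSum 5 fun a₅ =>
    Nat.pow 16384 (natSum 5 fun x => natSum 5 fun y => Nat.sub 1 (Nat.sub 1 (Nat.mod
      (Nat.add (Nat.add 1 (Nat.mul x (Nat.add a₁ (Nat.mul x a₃))))
        (Nat.mul y (Nat.add a₂ (Nat.add (Nat.mul x a₄) (Nat.mul y a₅))))) 5)))

/-- The `5 ^ 5 = 3125` conics are enumerated; the base exceeds their number. -/
theorem affineConicSumFive_eq : affineConicSumFive = Nat.ofDigits 16384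
    [0, 0, 0, 0, 0, 0, 0, 0, 0, 0, 0, 0, 0, 0, 0, 36, 240, 0, 0, 760, 528, 1260, 0, 0, 240, 61] := by
  decide +kernel

theorem hasTrivialStabilizer_reedMuller_of_card_eq_five (hF : Fintype.card F = 5) :
    HasTrivialStabilizer (weightEnumerator (reedMuller F 2 2)) := by
  classical
  rw [weightEnumerator_reedMuller_two_two (by omega) (b := 16384)
    (L := [1, 0, 0, 0, 0, 0, 0, 0, 0, 0, 0, 0, 0, 0, 0, 240, 1500, 0, 0, 4000, 2640, 6000, 0, 0,
      1000, 244])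
    (B := [0, 0, 0, 0, 0, 0, 0, 0, 0, 0, 0, 0, 0, 0, 0, 36, 240, 0, 0, 760, 528, 1260, 0, 0, 240, 61])
    (by rw [hF]; rfl) (by rw [hF]; rfl) (by decide) ?_ (by rw [hF]; norm_num) (by decide)
    (Eq.trans ?_ affineConicSumFive_eq)]
  · exact hasTrivialStabilizer_weightForm_affineConicFive
  · rw [hF]
    decide
  · simp only [sum_eq_sum_range_five hF, affineConicSumFive, natSum_eq_sum,
      ← ite_natCast_ne_zero_of_card_eq_five hF]
    refine Finset.sum_congr rfl fun a₁ _ => Finset.sum_congr rfl fun a₂ _ =>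
      Finset.sum_congr rfl fun a₃ _ => Finset.sum_congr rfl fun a₄ _ =>
      Finset.sum_congr rfl fun a₅ _ => congrArg (16384 ^ ·) ?_
    refine Finset.sum_congr rfl fun x _ => Finset.sum_congr rfl fun y _ => ?_
    simp only [Nat.add_eq, Nat.mul_eq, Nat.cast_add, Nat.cast_mul, Nat.cast_one]
    congr 2
    ring

end FiveElements

/-! ### Affine conics over the field with four elements -/

section FourElements

variable {F : Type*} [Field F] [Fintype F]

theorem exists_sq_eq_of_card_eq_four (hF : Fintype.card F = 4) :
    CharP F 2 ∧ ∃ ω : F, ω ≠ 0 ∧ ω ≠ 1 ∧ ω ^ 2 = ω + 1 := by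
  have : Fact (Nat.Prime 2) := ⟨Nat.prime_two⟩
  have hchar : CharP F 2 := charP_of_card_eq_prime_pow (f := 2) hF
  refine ⟨hchar, ?_⟩
  classical
  have hcard : Fintype.card Fˣ = 3 := by rw [Fintype.card_units, hF]
  have : Nontrivial Fˣ := Fintype.one_lt_card_iff_nontrivial.1 (by omega)
  obtain ⟨u, hu⟩ := exists_ne (1 : Fˣ)
  have hu1 : (u : F) ≠ 1 := fun h => hu (Units.ext h)
  have hu3 : (u : F) ^ 3 = 1 := by
    have := pow_card_eq_one (x := u)
    rw [hcard] at this
    rw [← Units.val_pow_eq_pow_val, this, Units.val_one]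
  refine ⟨u, u.ne_zero, hu1, ?_⟩
  have h2 : (2 : F) = 0 := CharTwo.two_eq_zero
  -- `u ^ 3 - 1 = (u - 1) * (u ^ 2 + u + 1)`, and signs do not matter in characteristic two.
  refine mul_left_cancel₀ (sub_ne_zero.2 hu1) ?_
  linear_combination hu3 - ((u : F) ^ 2 - 1) * h2

theorem natCast_add_natCast_mul_eq_zero_iff {F : Type*} [Field F] [CharP F 2] {ω : F} (h0 : ω ≠ 0) (h1 : ω ≠ 1)
    (m n : ℕ) : (m : F) + n * ω = 0 ↔ m % 2 = 0 ∧ n % 2 = 0 := by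
  have h2 : (2 : F) = 0 := CharTwo.two_eq_zero
  have hmod : ∀ k : ℕ, (k : F) = ((k % 2 : ℕ) : F) := fun k => by
    conv_lhs => rw [← Nat.mod_add_div k 2]
    push_cast
    rw [h2]
    ring
  have h1' : 1 + ω ≠ 0 := fun h => h1 (by linear_combination h - h2)
  rw [hmod m, hmod n]
  rcases Nat.mod_two_eq_zero_or_one m with hm | hm <;>
    rcases Nat.mod_two_eq_zero_or_one n with hn | hn <;> simp [hm, hn, h0, h1']

theorem sum_eq_sum_range_two [CharP F 2] (hF : Fintype.card F = 4) {ω : F} (h0 : ω ≠ 0)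
    (h1 : ω ≠ 1) {M : Type*} [AddCommMonoid M] (g : F → M) :
    ∑ x, g x = ∑ i ∈ Finset.range 2, ∑ j ∈ Finset.range 2, g (i + j * ω) := by
  have hbij : Function.Bijective fun p : Fin 2 × Fin 2 => ((p.1 : ℕ) : F) + (p.2 : ℕ) * ω := by
    rw [Fintype.bijective_iff_injective_and_card]
    refine ⟨?_, by simp [hF]⟩
    rintro ⟨i, j⟩ ⟨i', j'⟩ h
    have h : ((i : ℕ) : F) + (j : ℕ) * ω = (i' : ℕ) + (j' : ℕ) * ω := h
    have h2 : (2 : F) = 0 := CharTwo.two_eq_zero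
    have h3 : ((i + i' : ℕ) : F) + ((j + j' : ℕ) : F) * ω = 0 := by
      push_cast
      linear_combination h + (((i' : ℕ) : F) + (j' : ℕ) * ω) * h2
    rw [natCast_add_natCast_mul_eq_zero_iff h0 h1] at h3
    refine Prod.ext (Fin.ext ?_) (Fin.ext ?_)
    · change (i : ℕ) = i'
      omega
    · change (j : ℕ) = j'
      omega
  rw [← hbij.sum_comp g, Fintype.sum_prod_type,
    Fin.sum_univ_eq_sum_range (fun i => ∑ j : Fin 2, g ((i : F) + (j : ℕ) * ω))]
  exact Finset.sum_congr rfl fun i _ =>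
    Fin.sum_univ_eq_sum_range (fun j => g ((i : F) + (j : F) * ω)) 2

open Classical in
theorem ite_ne_zero_of_card_eq_four {F : Type*} [Field F] [CharP F 2] {ω : F} (h0 : ω ≠ 0) (h1 : ω ≠ 1) (m n : ℕ) :
    (if (m : F) + n * ω ≠ 0 then 1 else 0) =
      Nat.sub 1 (Nat.sub 1 (Nat.add (Nat.mod m 2) (Nat.mod n 2))) := by
  have h := natCast_add_natCast_mul_eq_zero_iff h0 h1 m n
  change _ = 1 - (1 - (m % 2 + n % 2))
  split_ifs with h'
  · rw [ne_eq, h] at h'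
    omega
  · rw [not_not, h] at h'
    omega

/-- The generating function of the weights of the conics `f` with `f(0, 0) = 1` in the affine plane
over the field with four elements, evaluated at `2 ^ 11`. The coefficient of `x` is `a + b * ω`
with `ω ^ 2 = ω + 1`, and so on; the point is `(s + t * ω, u + v * ω)`. -/
def affineConicSumFour : ℕ :=
  natSum 2 fun a => natSum 2 fun b => natSum 2 fun c => natSum 2 fun d => natSum 2 fun e =>
  natSum 2 fun f => natSum 2 fun g => natSum 2 fun h => natSum 2 fun i => natSum 2 fun j =>
    Nat.pow 2048 (natSum 2 fun s => natSum 2 fun t => natSum 2 fun u => natSum 2 fun v =>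
      Nat.sub 1 (Nat.sub 1 (Nat.add
        (Nat.mod (1 + a * s + b * t + c * u + d * v + e * (s * s + t * t) +
          f * (2 * s * t + t * t) + g * (s * u + t * v) + h * (s * v + t * u + t * v) +
          i * (u * u + v * v) + j * (2 * u * v + v * v)) 2)
        (Nat.mod (a * t + b * (s + t) + c * v + d * (u + v) + e * (2 * s * t + t * t) +
          f * (s * s + t * t + 2 * s * t + t * t) + g * (s * v + t * u + t * v) +
          h * (s * u + t * v + s * v + t * u + t * v) +
          i * (2 * u * v + v * v) + j * (u * u + v * v + 2 * u * v + v * v)) 2))))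

/-- The `4 ^ 5 = 1024` conics are enumerated; the base exceeds their number. -/
theorem affineConicSumFour_eq : affineConicSumFour = Nat.ofDigits 2048
    [0, 0, 0, 0, 0, 0, 0, 0, 15, 90, 0, 198, 210, 390, 0, 90, 31] := by
  decide +kernel

theorem hasTrivialStabilizer_reedMuller_of_card_eq_four (hF : Fintype.card F = 4) :
    HasTrivialStabilizer (weightEnumerator (reedMuller F 2 2)) := by
  classical
  obtain ⟨hchar, ω, h0, h1, hω⟩ := exists_sq_eq_of_card_eq_four hF
  rw [weightEnumerator_reedMuller_two_two (by omega) (b := 2048)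
    (L := [1, 0, 0, 0, 0, 0, 0, 0, 90, 480, 0, 864, 840, 1440, 0, 288, 93])
    (B := [0, 0, 0, 0, 0, 0, 0, 0, 15, 90, 0, 198, 210, 390, 0, 90, 31])
    (by rw [hF]; rfl) (by rw [hF]; rfl) (by decide) ?_ (by rw [hF]; norm_num) (by decide)
    (Eq.trans ?_ affineConicSumFour_eq)]
  · exact hasTrivialStabilizer_weightForm_affineConicFour
  · rw [hF]
    decide
  · rw [affineConicSumFour]
    rw [sum_eq_sum_range_two hF h0 h1, natSum_eq_sum]
    refine Finset.sum_congr rfl fun a _ => ?_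
    rw [natSum_eq_sum]
    refine Finset.sum_congr rfl fun b _ => ?_
    rw [sum_eq_sum_range_two hF h0 h1, natSum_eq_sum]
    refine Finset.sum_congr rfl fun c _ => ?_
    rw [natSum_eq_sum]
    refine Finset.sum_congr rfl fun d _ => ?_
    rw [sum_eq_sum_range_two hF h0 h1, natSum_eq_sum]
    refine Finset.sum_congr rfl fun e _ => ?_
    rw [natSum_eq_sum]
    refine Finset.sum_congr rfl fun f _ => ?_
    rw [sum_eq_sum_range_two hF h0 h1, natSum_eq_sum]
    refine Finset.sum_congr rfl fun g _ => ?_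
    rw [natSum_eq_sum]
    refine Finset.sum_congr rfl fun h _ => ?_
    rw [sum_eq_sum_range_two hF h0 h1, natSum_eq_sum]
    refine Finset.sum_congr rfl fun i _ => ?_
    rw [natSum_eq_sum]
    refine Finset.sum_congr rfl fun j _ => ?_
    refine congrArg (2048 ^ ·) ?_
    rw [sum_eq_sum_range_two hF h0 h1, natSum_eq_sum]
    refine Finset.sum_congr rfl fun s _ => ?_
    rw [natSum_eq_sum]
    refine Finset.sum_congr rfl fun t _ => ?_
    rw [sum_eq_sum_range_two hF h0 h1, natSum_eq_sum]
    refine Finset.sum_congr rfl fun u _ => ?_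
    rw [natSum_eq_sum]
    refine Finset.sum_congr rfl fun v _ => ?_
    refine Eq.trans ?_ (ite_ne_zero_of_card_eq_four h0 h1 _ _)
    congr 2
    simp only [Nat.cast_add, Nat.cast_mul, Nat.cast_one, Nat.cast_ofNat]
    -- The two components are expanded with `ω ^ 2 = ω + 1` alone and the even terms kept, so
    -- characteristic two is not needed here.
    linear_combination (b * t + d * v + e * t ^ 2 + f * (2 * s * t + t ^ 2 * (ω + 1)) + g * t * v +
      h * (s * v + t * u + t * v * (ω + 1)) + i * v ^ 2 + j * (2 * u * v + v ^ 2 * (ω + 1))) * hω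

end FourElements

/-! ### Forms on the whole vector space -/

section HomogeneousCode

open MvPolynomial

variable {F : Type*} [Field F]

/-- The code of the values of the forms of degree `r` at all vectors. -/
noncomputable def homogeneousCode (F : Type*) [Field F] (r m : ℕ) :
    Submodule F ((Fin (m + 1) → F) → F) :=
  (homogeneousSubmodule (Fin (m + 1)) F r).map (evalAt fun v => v)

theorem apply_smul_of_mem_homogeneousCode {r m : ℕ} {c : (Fin (m + 1) → F) → F}
    (hc : c ∈ homogeneousCode F r m) (a : F) (v : Fin (m + 1) → F) :
    c (a • v) = a ^ r * c v := by
  obtain ⟨p, hp, rfl⟩ := hc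
  rw [evalAt_apply, evalAt_apply]
  exact MvPolynomial.IsHomogeneous.eval_smul hp a v

theorem apply_zero_of_mem_homogeneousCode {r m : ℕ} (hr : r ≠ 0) {c : (Fin (m + 1) → F) → F}
    (hc : c ∈ homogeneousCode F r m) : c 0 = 0 := by
  have := apply_smul_of_mem_homogeneousCode hc 0 0
  rwa [zero_pow hr, zero_mul, zero_smul] at this

theorem comp_mem_homogeneousCode {r m : ℕ} {c : (Fin (m + 1) → F) → F}
    (hc : c ∈ homogeneousCode F r m) (g : (Fin (m + 1) → F) →ₗ[F] (Fin (m + 1) → F)) :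
    c ∘ g ∈ homogeneousCode F r m := by
  obtain ⟨p, hp, rfl⟩ := hc
  let l : Fin (m + 1) → MvPolynomial (Fin (m + 1)) F := fun i =>
    ∑ j, C (g (Pi.single j 1) i) * X j
  have hl : ∀ i, (l i).IsHomogeneous 1 := fun i =>
    IsHomogeneous.sum _ _ _ fun j _ => (isHomogeneous_X F j).C_mul _
  refine ⟨aeval l p, ?_, ?_⟩
  · have := IsHomogeneous.aeval (p.mem_homogeneousSubmodule r |>.1 hp) l hl
    rwa [one_mul] at this
  · ext v
    rw [Function.comp_apply, evalAt_apply, evalAt_apply]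
    have hv : ∀ i, eval v (l i) = g v i := by
      intro i
      have : g v = ∑ j, v j • g (Pi.single j 1) := by
        conv_lhs => rw [← Finset.univ_sum_single v, map_sum]
        refine Finset.sum_congr rfl fun j _ => ?_
        rw [← map_smul, ← Pi.single_smul, smul_eq_mul, mul_one]
      rw [this]
      simp [l, mul_comm]
    have hcomp : (aeval v : MvPolynomial (Fin (m + 1)) F →ₐ[F] F).comp (aeval l) = aeval (g v) := by
      refine algHom_ext fun i => ?_
      rw [AlgHom.comp_apply, aeval_X, aeval_X, aeval_eq_eval]
      exact hv i
    have := DFunLike.congr_fun hcomp p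
    rwa [AlgHom.comp_apply, aeval_eq_eval, aeval_eq_eval] at this

/-- The isomorphism of the lines spanned by `x` and `y` extends to the whole space. -/
theorem exists_linearEquiv_apply_eq {V : Type*} [AddCommGroup V] [Module F V]
    {x y : V} (hx : x ≠ 0) (hy : y ≠ 0) : ∃ g : V ≃ₗ[F] V, g x = y := by
  obtain ⟨g, hg⟩ := Submodule.exists_linearEquiv_restrict_eq
    ((LinearEquiv.toSpanNonzeroSingleton F V x hx).symm.trans
      (LinearEquiv.toSpanNonzeroSingleton F V y hy))
  refine ⟨g, ?_⟩
  have h1 := hg ⟨x, Submodule.mem_span_singleton_self x⟩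
  have h2 : (LinearEquiv.toSpanNonzeroSingleton F V x hx).symm
      ⟨x, Submodule.mem_span_singleton_self x⟩ = 1 := by
    rw [LinearEquiv.symm_apply_eq, LinearEquiv.toSpanNonzeroSingleton_one]
  rw [← h1, LinearEquiv.trans_apply, h2, LinearEquiv.toSpanNonzeroSingleton_one]

theorem finrank_homogeneousCode [Fintype F] {r : ℕ} (m : ℕ) (hr : r < Fintype.card F) :
    Module.finrank F (homogeneousCode F r m) = (m + 1).multichoose r := by
  rw [← natCard_degree_eq, homogeneousCode, homogeneousSubmodule_eq_finsupp_supported]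
  refine finrank_map_evalAt _ _ fun p hp h => ?_
  have hp : p.IsHomogeneous r := by
    rw [← mem_homogeneousSubmodule, homogeneousSubmodule_eq_finsupp_supported]
    exact hp
  exact eq_zero_of_forall_eval_eq_zero_of_totalDegree_lt
    (lt_of_le_of_lt hp.totalDegree_le hr) h

open Classical in
-- Every zero or nonzero value at a point of `R` is repeated on its `q - 1` multiples, and the
-- origin contributes nothing. On all vectors the linear group permutes coordinates outright,
-- whereas on `R` it does so only up to scalars.
theorem weightCount_projReedMuller [Fintype F] {r m : ℕ} (hr : r ≠ 0)
    {R : Finset (Fin (m + 1) → F)} (hR : IsProjectiveRepresentatives R) (w : ℕ) :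
    weightCount (projReedMuller r m R) w =
      weightCount (homogeneousCode F r m) ((Fintype.card F - 1) * w) := by
  have hq : 0 < Fintype.card F - 1 := Nat.sub_pos_of_lt Fintype.one_lt_card
  have hnorm : ∀ c ∈ homogeneousCode F r m,
      hammingNorm c = (Fintype.card F - 1) * hammingNorm fun v : R => c v := by
    intro c hc
    rw [hammingNorm, Finset.card_filter, ← Finset.add_sum_erase _ _ (Finset.mem_univ 0),
      apply_zero_of_mem_homogeneousCode hr hc, if_neg (by simp), zero_add, hR.sum_ne_zero,
      hammingNorm, Finset.card_filter, Finset.mul_sum]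
    refine Finset.sum_congr rfl fun v _ => ?_
    simp [apply_smul_of_mem_homogeneousCode hc, Fintype.card_units]
  symm
  refine Finset.card_bij (fun c _ => ⟨fun v : R => (c : (Fin (m + 1) → F) → F) v, ?_⟩) ?_ ?_ ?_
  · obtain ⟨p, hp, hpc⟩ := c.2
    exact ⟨p, hp, by rw [← hpc]; rfl⟩
  · intro c hc
    simp only [Finset.mem_filter, Finset.mem_univ, true_and] at hc ⊢
    rw [hnorm c c.2] at hc
    exact Nat.eq_of_mul_eq_mul_left hq hc
  · intro c _ d _ hcd
    refine Subtype.ext (funext fun v => ?_)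
    by_cases hv : v = 0
    · rw [hv, apply_zero_of_mem_homogeneousCode hr c.2, apply_zero_of_mem_homogeneousCode hr d.2]
    · obtain ⟨⟨a, u⟩, hau⟩ := hR.bijective_smul.2 ⟨v, hv⟩
      have hau : (a : F) • (u : Fin (m + 1) → F) = v := congrArg Subtype.val hau
      rw [← hau, apply_smul_of_mem_homogeneousCode c.2, apply_smul_of_mem_homogeneousCode d.2]
      congr 1
      exact congrFun (congrArg Subtype.val hcd) u
  · rintro ⟨_, p, hp, rfl⟩ hw
    refine ⟨⟨evalAt (fun v => v) p, p, hp, rfl⟩, ?_, rfl⟩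
    simp only [Finset.mem_filter, Finset.mem_univ, true_and] at hw ⊢
    rw [hnorm _ ⟨p, hp, rfl⟩, ← hw]
    rfl

theorem mul_weightCount_homogeneousCode [Fintype F] {r m : ℕ} (hr : r ≠ 0)
    {v₀ : Fin (m + 1) → F} (hv₀ : v₀ ≠ 0) (w : ℕ) :
    w * weightCount (homogeneousCode F r m) w =
      (Fintype.card F ^ (m + 1) - 1) * (Fintype.card F - 1) *
        weightCountAt (homogeneousCode F r m) v₀ w := by
  classical
  rw [mul_weightCount (J := Finset.univ.erase 0) (i₀ := v₀)]
  · rw [Finset.card_erase_of_mem (Finset.mem_univ _), Finset.card_univ, Fintype.card_fun,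
      Fintype.card_fin]
  · intro c hc v hv
    have : v = 0 := by simpa using hv
    rw [this, apply_zero_of_mem_homogeneousCode hr hc]
  · intro v hv
    obtain ⟨g, hg⟩ := exists_linearEquiv_apply_eq (F := F) hv₀ (Finset.ne_of_mem_erase hv)
    exact ⟨g.toEquiv, hg, fun c hc => comp_mem_homogeneousCode hc g.toLinearMap⟩

end HomogeneousCode

/-! ### Plane cubics: removing the quadratic term and slicing by lines -/

section PlaneCubics

variable {F : Type*} [Field F]

/-- The function on `F ^ 3` that is given by a cubic form. -/
def planeCubic (F : Type*) [Field F] : (Fin 10 → F) →ₗ[F] ((Fin 3 → F) → F) where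
  toFun a v := a 0 * v 2 ^ 3 + (a 1 * v 0 + a 2 * v 1) * v 2 ^ 2 +
    (a 3 * v 0 ^ 2 + a 4 * (v 0 * v 1) + a 5 * v 1 ^ 2) * v 2 +
    (a 6 * v 0 ^ 3 + a 7 * (v 0 ^ 2 * v 1) + a 8 * (v 0 * v 1 ^ 2) + a 9 * v 1 ^ 3)
  map_add' a b := by
    ext v
    simp only [Pi.add_apply]
    ring
  map_smul' c a := by
    ext v
    simp only [Pi.smul_apply, smul_eq_mul, RingHom.id_apply]
    ring

theorem planeCubic_apply (a : Fin 10 → F) (v : Fin 3 → F) : planeCubic F a v =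
    a 0 * v 2 ^ 3 + (a 1 * v 0 + a 2 * v 1) * v 2 ^ 2 +
    (a 3 * v 0 ^ 2 + a 4 * (v 0 * v 1) + a 5 * v 1 ^ 2) * v 2 +
    (a 6 * v 0 ^ 3 + a 7 * (v 0 ^ 2 * v 1) + a 8 * (v 0 * v 1 ^ 2) + a 9 * v 1 ^ 3) := rfl

theorem homogeneousCode_three_two_le :
    homogeneousCode F 3 2 ≤ LinearMap.range (planeCubic F) := by
  rw [homogeneousCode, MvPolynomial.homogeneousSubmodule_eq_finsupp_supported]
  refine map_evalAt_le (S := {d | Finsupp.degree d = 3}) fun d hd => ?_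
  have hd' : d 0 + d 1 + d 2 = 3 := by
    have : Finsupp.degree d = 3 := hd
    rwa [Finsupp.degree_eq_sum, Fin.sum_univ_three] at this
  have key : ∀ i j k : ℕ, i + j + k = 3 →
      (fun v : Fin 3 → F => v 0 ^ i * v 1 ^ j * v 2 ^ k) ∈ LinearMap.range (planeCubic F) := by
    intro i j k hijk
    have hi : i ≤ 3 := by omega
    have hj : j ≤ 3 := by omega
    obtain rfl : k = 3 - i - j := by omega
    interval_cases i <;> interval_cases j <;> first | omega | skip
    · exact ⟨Pi.single 0 1, by ext v; simp [planeCubic_apply]⟩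
    · exact ⟨Pi.single 2 1, by ext v; simp [planeCubic_apply]⟩
    · exact ⟨Pi.single 5 1, by ext v; simp [planeCubic_apply]⟩
    · exact ⟨Pi.single 9 1, by ext v; simp [planeCubic_apply]⟩
    · exact ⟨Pi.single 1 1, by ext v; simp [planeCubic_apply]⟩
    · exact ⟨Pi.single 4 1, by ext v; simp [planeCubic_apply]⟩
    · exact ⟨Pi.single 8 1, by ext v; simp [planeCubic_apply]⟩
    · exact ⟨Pi.single 3 1, by ext v; simp [planeCubic_apply]⟩
    · exact ⟨Pi.single 7 1, by ext v; simp [planeCubic_apply]⟩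
    · exact ⟨Pi.single 6 1, by ext v; simp [planeCubic_apply]⟩
  simpa [Fin.prod_univ_three] using key (d 0) (d 1) (d 2) hd'

theorem planeCubic_injective_and_range_eq [Fintype F] (hq : 3 < Fintype.card F) :
    Function.Injective (planeCubic F) ∧ LinearMap.range (planeCubic F) = homogeneousCode F 3 2 :=
  injective_and_range_eq homogeneousCode_three_two_le (by
    rw [finrank_homogeneousCode 2 hq, Nat.multichoose_eq, Module.finrank_fintype_fun_eq_card]
    rfl)

theorem hammingNorm_comp_perm {ι α : Type*} [Fintype ι] [Zero α] [DecidableEq α] (c : ι → α)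
    (σ : Equiv.Perm ι) : hammingNorm (c ∘ σ) = hammingNorm c := by
  rw [hammingNorm, hammingNorm, Finset.card_filter, Finset.card_filter]
  exact Equiv.sum_comp σ fun i => if c i ≠ 0 then 1 else 0

/-- The coefficients after the quadratic term of a monic cubic in the last variable has been removed
by a translation; the characteristic is `5`. -/
def depressCubic (α β : F) (b : Fin 7 → F) : Fin 7 → F :=
  ![b 0 + 3 * α ^ 2, b 1 + 6 * α * β, b 2 + 3 * β ^ 2,
    b 3 + 3 * (α * b 0) + α ^ 3, b 4 + 3 * (α * b 1 + β * b 0) + 3 * α ^ 2 * β,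
    b 5 + 3 * (α * b 2 + β * b 1) + 3 * α * β ^ 2, b 6 + 3 * (β * b 2) + β ^ 3]

/-- The translation of the last coordinate by `3 * (α * x + β * y)`. -/
def shearPerm (α β : F) : Equiv.Perm (Fin 3 → F) where
  toFun v := ![v 0, v 1, v 2 + 3 * (α * v 0 + β * v 1)]
  invFun v := ![v 0, v 1, v 2 - 3 * (α * v 0 + β * v 1)]
  left_inv v := by
    ext i
    fin_cases i <;> simp
  right_inv v := by
    ext i
    fin_cases i <;> simp

/-- In characteristic five `-1 / 3 = 3`, so this is the usual shift that completes the cube. -/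
theorem planeCubic_comp_shearPerm [CharP F 5] (α β : F) (b : Fin 7 → F) :
    planeCubic F (Matrix.vecCons 1 (Matrix.vecCons α (Matrix.vecCons β b))) ∘ shearPerm α β =
      planeCubic F (Matrix.vecCons 1 (Matrix.vecCons 0 (Matrix.vecCons 0 (depressCubic α β b)))) := by
  have h5 : (5 : F) = 0 := by exact_mod_cast CharP.cast_eq_zero F 5
  ext v
  simp only [Function.comp_apply, planeCubic_apply, shearPerm, Equiv.coe_fn_mk, depressCubic]
  change (1 : F) * (v 2 + 3 * (α * v 0 + β * v 1)) ^ 3 +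
    (α * v 0 + β * v 1) * (v 2 + 3 * (α * v 0 + β * v 1)) ^ 2 +
    (b 0 * v 0 ^ 2 + b 1 * (v 0 * v 1) + b 2 * v 1 ^ 2) * (v 2 + 3 * (α * v 0 + β * v 1)) +
    (b 3 * v 0 ^ 3 + b 4 * (v 0 ^ 2 * v 1) + b 5 * (v 0 * v 1 ^ 2) + b 6 * v 1 ^ 3) =
    1 * v 2 ^ 3 + (0 * v 0 + 0 * v 1) * v 2 ^ 2 +
    ((b 0 + 3 * α ^ 2) * v 0 ^ 2 + (b 1 + 6 * α * β) * (v 0 * v 1) +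
      (b 2 + 3 * β ^ 2) * v 1 ^ 2) * v 2 +
    ((b 3 + 3 * (α * b 0) + α ^ 3) * v 0 ^ 3 +
      (b 4 + 3 * (α * b 1 + β * b 0) + 3 * α ^ 2 * β) * (v 0 ^ 2 * v 1) +
      (b 5 + 3 * (α * b 2 + β * b 1) + 3 * α * β ^ 2) * (v 0 * v 1 ^ 2) +
      (b 6 + 3 * (β * b 2) + β ^ 3) * v 1 ^ 3)
  linear_combination (2 * (α * v 0 + β * v 1) * v 2 ^ 2 + 6 * (α * v 0 + β * v 1) ^ 2 * v 2 +
    7 * (α * v 0 + β * v 1) ^ 3) * h5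

/-- The shear is invertible and, as `q > 3`, a cubic form is determined by its values. -/
theorem depressCubic_bijective [Fintype F] [CharP F 5] (hq : 3 < Fintype.card F) (α β : F) :
    Function.Bijective (depressCubic α β) := by
  refine Finite.injective_iff_bijective.1 fun b c hbc => ?_
  have h : planeCubic F (Matrix.vecCons 1 (Matrix.vecCons α (Matrix.vecCons β b))) ∘
      shearPerm α β =
      planeCubic F (Matrix.vecCons 1 (Matrix.vecCons α (Matrix.vecCons β c))) ∘ shearPerm α β := by
    rw [planeCubic_comp_shearPerm, planeCubic_comp_shearPerm, hbc]
  have h' := (planeCubic_injective_and_range_eq hq).1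
    ((shearPerm α β).surjective.injective_comp_right h)
  simpa [Matrix.vecCons_inj] using h'

open Classical in
/-- The number of elements at which a monic cubic without quadratic term does not vanish. -/
noncomputable def depressedCubicWeight [Fintype F] (B T : F) : ℕ :=
  ∑ z : F, if z ^ 3 + B * z + T ≠ 0 then 1 else 0

theorem depressedCubicWeight_mul [Fintype F] {a : F} (ha : a ≠ 0) (B T : F) :
    depressedCubicWeight (a ^ 2 * B) (a ^ 3 * T) = depressedCubicWeight B T := by
  classical
  rw [depressedCubicWeight, depressedCubicWeight]
  refine (Fintype.sum_equiv (Equiv.mulLeft₀ a ha) _ _ fun z => ?_).symm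
  have h : (a * z) ^ 3 + a ^ 2 * B * (a * z) + a ^ 3 * T = a ^ 3 * (z ^ 3 + B * z + T) := by ring
  change _ = if (a * z) ^ 3 + a ^ 2 * B * (a * z) + a ^ 3 * T ≠ 0 then 1 else 0
  simp only [h]
  simp [ha]

theorem depressedCubicWeight_zero [Fintype F] :
    depressedCubicWeight (0 : F) 0 = Fintype.card F - 1 := by
  classical
  simp [depressedCubicWeight, Finset.sum_ite, Finset.filter_ne', Finset.card_erase_of_mem]

open Classical in
-- On the lines through `(0 : 0 : 1)`, which itself gives the summand `1`, the form is a depressed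
-- cubic in `z`. The line over `(0 : 1)` gives the second summand and the lines over `(1 : m)` the
-- last sum. Weights over proportional `(x, y)` agree by `depressedCubicWeight_mul`.
theorem hammingNorm_planeCubic [Fintype F] (b₀ b₁ b₂ t₀ t₁ t₂ t₃ : F) :
    hammingNorm (planeCubic F ![1, 0, 0, b₀, b₁, b₂, t₀, t₁, t₂, t₃]) = (Fintype.card F - 1) *
      (1 + (depressedCubicWeight b₂ t₃ + ∑ m : F, depressedCubicWeight
        (b₀ + m * (b₁ + m * b₂)) (t₀ + m * (t₁ + m * (t₂ + m * t₃))))) := by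
  have h1 : hammingNorm (planeCubic F ![1, 0, 0, b₀, b₁, b₂, t₀, t₁, t₂, t₃]) =
      ∑ x : F, ∑ y : F, depressedCubicWeight (b₀ * x ^ 2 + b₁ * (x * y) + b₂ * y ^ 2)
        (t₀ * x ^ 3 + t₁ * (x ^ 2 * y) + t₂ * (x * y ^ 2) + t₃ * y ^ 3) := by
    rw [hammingNorm, Finset.card_filter]
    simp only [sum_vecCons, Finset.univ_unique, Finset.sum_singleton]
    refine Finset.sum_congr rfl fun x _ => Finset.sum_congr rfl fun y _ =>
      Finset.sum_congr rfl fun z _ => ?_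
    have h : planeCubic F ![1, 0, 0, b₀, b₁, b₂, t₀, t₁, t₂, t₃] ![x, y, z] =
        z ^ 3 + (b₀ * x ^ 2 + b₁ * (x * y) + b₂ * y ^ 2) * z +
        (t₀ * x ^ 3 + t₁ * (x ^ 2 * y) + t₂ * (x * y ^ 2) + t₃ * y ^ 3) := by
      change (1 : F) * z ^ 3 + (0 * x + 0 * y) * z ^ 2 +
        (b₀ * x ^ 2 + b₁ * (x * y) + b₂ * y ^ 2) * z +
        (t₀ * x ^ 3 + t₁ * (x ^ 2 * y) + t₂ * (x * y ^ 2) + t₃ * y ^ 3) = _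
      ring
    rw [← h]
    rfl
  have h2 : ∀ x ∈ Finset.univ.erase (0 : F),
      ∑ y : F, depressedCubicWeight (b₀ * x ^ 2 + b₁ * (x * y) + b₂ * y ^ 2)
        (t₀ * x ^ 3 + t₁ * (x ^ 2 * y) + t₂ * (x * y ^ 2) + t₃ * y ^ 3) =
      ∑ m : F, depressedCubicWeight
        (b₀ + m * (b₁ + m * b₂)) (t₀ + m * (t₁ + m * (t₂ + m * t₃))) := by
    intro x hx
    refine (Fintype.sum_equiv (Equiv.mulLeft₀ x (Finset.ne_of_mem_erase hx)) _ _ fun m => ?_).symm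
    rw [← depressedCubicWeight_mul (Finset.ne_of_mem_erase hx)]
    change _ = depressedCubicWeight (b₀ * x ^ 2 + b₁ * (x * (x * m)) + b₂ * (x * m) ^ 2)
      (t₀ * x ^ 3 + t₁ * (x ^ 2 * (x * m)) + t₂ * (x * (x * m) ^ 2) + t₃ * (x * m) ^ 3)
    congr 1 <;> ring
  have h3 : ∀ y ∈ Finset.univ.erase (0 : F),
      depressedCubicWeight (b₀ * 0 ^ 2 + b₁ * (0 * y) + b₂ * y ^ 2)
        (t₀ * 0 ^ 3 + t₁ * (0 ^ 2 * y) + t₂ * (0 * y ^ 2) + t₃ * y ^ 3) =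
      depressedCubicWeight b₂ t₃ := by
    intro y hy
    rw [← depressedCubicWeight_mul (Finset.ne_of_mem_erase hy) b₂ t₃]
    congr 1 <;> ring
  have h4 : depressedCubicWeight (b₀ * 0 ^ 2 + b₁ * (0 * 0) + b₂ * 0 ^ 2)
      (t₀ * 0 ^ 3 + t₁ * (0 ^ 2 * 0) + t₂ * (0 * 0 ^ 2) + t₃ * 0 ^ 3) = Fintype.card F - 1 := by
    rw [← depressedCubicWeight_zero]
    congr 1 <;> ring
  rw [h1, ← Finset.add_sum_erase _ _ (Finset.mem_univ 0), Finset.sum_congr rfl h2,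
    ← Finset.add_sum_erase _ _ (Finset.mem_univ 0), Finset.sum_congr rfl h3, h4, Finset.sum_const,
    Finset.sum_const, Finset.card_erase_of_mem (Finset.mem_univ _), Finset.card_univ, smul_eq_mul,
    smul_eq_mul]
  ring

end PlaneCubics

/-! ### Plane cubics over the field with five elements -/

section PlaneCubicsFive

variable {F : Type*} [Field F] [Fintype F]

/-- The number of elements `z` modulo `5` with `z ^ 3 + B * z + T ≠ 0`, from a table. -/
def depressedCubicTable (B T : ℕ) : ℕ :=
  Nat.mod (Nat.shiftRight 22249613881514845882660
    (Nat.mul 3 (Nat.add (Nat.mul 5 (Nat.mod B 5)) (Nat.mod T 5)))) 8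

/-- The constant packs the 25 counts in three bits each, the one for `(B, T)` at position `5 * B +
T`. -/
theorem depressedCubicTable_eq : ∀ B < 5, ∀ T < 5,
    ∑ z ∈ Finset.range 5, Nat.sub 1 (Nat.sub 1 (Nat.mod (z ^ 3 + B * z + T) 5)) =
      depressedCubicTable B T := by
  decide +kernel

theorem depressedCubicWeight_natCast (hF : Fintype.card F = 5) (B T : ℕ) :
    depressedCubicWeight (B : F) T = depressedCubicTable B T := by
  have := charP_of_card_eq_five hF
  have hmod : ∀ k : ℕ, (k : F) = ((k % 5 : ℕ) : F) := fun k =>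
    (CharP.natCast_eq_natCast F 5).2 (Nat.mod_modEq k 5).symm
  have htab : depressedCubicTable B T = depressedCubicTable (B % 5) (T % 5) := by
    change _ = Nat.mod (Nat.shiftRight _ (Nat.mul 3 (Nat.add (Nat.mul 5 (B % 5 % 5))
      (T % 5 % 5)))) 8
    rw [Nat.mod_mod, Nat.mod_mod]
    rfl
  rw [htab, hmod B, hmod T, ← depressedCubicTable_eq _ (Nat.mod_lt B (by norm_num)) _
    (Nat.mod_lt T (by norm_num)), depressedCubicWeight, sum_eq_sum_range_five hF]
  refine Finset.sum_congr rfl fun z _ => ?_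
  rw [← ite_natCast_ne_zero_of_card_eq_five hF]
  congr 2
  push_cast
  rfl

/-- The generating function of the weights of the cubics `z ^ 3 + g z + h` in the projective plane
over the field with five elements, where `g` and `h` are binary forms, evaluated at `2 ^ 24`. -/
def planeCubicSum : ℕ :=
  natSum 5 fun b₀ => natSum 5 fun b₁ => natSum 5 fun b₂ =>
  natSum 5 fun t₀ => natSum 5 fun t₁ => natSum 5 fun t₂ => natSum 5 fun t₃ =>
    Nat.pow 16777216 (Nat.add 1 (Nat.add (depressedCubicTable b₂ t₃)
      (natSum 5 fun m => depressedCubicTable (Nat.add b₀ (Nat.mul m (Nat.add b₁ (Nat.mul m b₂))))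
        (Nat.add t₀ (Nat.mul m (Nat.add t₁ (Nat.mul m (Nat.add t₂ (Nat.mul m t₃)))))))))

/-- The factor 25 counts the removed pairs `(α, β)`; the base `2 ^ 24` exceeds the total `5 ^ 9`. -/
theorem planeCubicSum_eq : 25 * planeCubicSum = Nat.ofDigits 16777216
    [0, 0, 0, 0, 0, 0, 0, 0, 0, 0, 0, 0, 0, 0, 0, 300, 2000, 0, 0, 19000, 12600, 94500, 132000,
      207000, 294000, 376525, 312000, 243000, 168000, 87000, 1200, 4000] := by
  decide +kernel

theorem sum_fin_seven {α M : Type*} [AddCommMonoid M] [Fintype α] (g : (Fin 7 → α) → M) :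
    ∑ a, g a = ∑ b₀ : α, ∑ b₁ : α, ∑ b₂ : α, ∑ t₀ : α, ∑ t₁ : α, ∑ t₂ : α, ∑ t₃ : α,
      g ![b₀, b₁, b₂, t₀, t₁, t₂, t₃] := by
  simp only [sum_vecCons, Finset.univ_unique, Finset.sum_singleton]
  rfl

open Classical in
theorem hammingNorm_planeCubic_eq_depressCubic [CharP F 5] (α β : F) (b : Fin 7 → F) :
    hammingNorm (planeCubic F (Matrix.vecCons 1 (Matrix.vecCons α (Matrix.vecCons β b)))) =
      hammingNorm (planeCubic F (Matrix.vecCons 1 (Matrix.vecCons 0 (Matrix.vecCons 0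
        (depressCubic α β b))))) := by
  rw [← planeCubic_comp_shearPerm, hammingNorm_comp_perm]

open Classical in
theorem card_sub_one_dvd_hammingNorm_planeCubic [CharP F 5] (a : Fin 9 → F) :
    Fintype.card F - 1 ∣ hammingNorm (planeCubic F (Matrix.vecCons 1 a)) := by
  have ha : a = Matrix.vecCons (a 0) (Matrix.vecCons (a 1) fun i => a i.succ.succ) := by
    ext i
    refine Fin.cases rfl (fun i => Fin.cases rfl (fun i => rfl) i) i
  rw [ha, hammingNorm_planeCubic_eq_depressCubic]
  exact ⟨_, hammingNorm_planeCubic _ _ _ _ _ _ _⟩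

open Classical in
theorem sum_pow_hammingNorm_planeCubic (hF : Fintype.card F = 5) :
    ∑ a : Fin 9 → F, 16777216 ^ (hammingNorm (planeCubic F (Matrix.vecCons 1 a)) / 4) =
      25 * planeCubicSum := by
  have := charP_of_card_eq_five hF
  have h1 : ∀ α β : F, ∑ b : Fin 7 → F, 16777216 ^ (hammingNorm (planeCubic F
      (Matrix.vecCons 1 (Matrix.vecCons α (Matrix.vecCons β b)))) / 4) = planeCubicSum := by
    intro α β
    refine (Finset.sum_congr rfl fun b _ => congrArg (fun k => 16777216 ^ (k / 4))
      (hammingNorm_planeCubic_eq_depressCubic α β b)).trans ?_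
    rw [(depressCubic_bijective (by omega) α β).sum_comp (fun b => 16777216 ^ (hammingNorm
      (planeCubic F (Matrix.vecCons 1 (Matrix.vecCons 0 (Matrix.vecCons 0 b)))) / 4)),
      sum_fin_seven, planeCubicSum]
    iterate 7
      rw [sum_eq_sum_range_five hF, natSum_eq_sum]
      refine Finset.sum_congr rfl fun _ _ => ?_
    refine congrArg (16777216 ^ ·) ?_
    rw [hammingNorm_planeCubic, hF, Nat.mul_div_cancel_left _ (by norm_num),
      sum_eq_sum_range_five hF, natSum_eq_sum]
    refine congrArg₂ (· + ·) rfl (congrArg₂ (· + ·) (depressedCubicWeight_natCast hF _ _) ?_)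
    refine Finset.sum_congr rfl fun m _ => ?_
    rw [← depressedCubicWeight_natCast hF]
    simp only [Nat.add_eq, Nat.mul_eq, Nat.cast_add, Nat.cast_mul]
  rw [sum_vecCons]
  simp only [sum_vecCons (k := 7), h1, Finset.sum_const, Finset.card_univ, hF, smul_eq_mul]
  ring

theorem weightEnumerator_projReedMuller_three_two (hF : Fintype.card F = 5)
    {R : Finset (Fin 3 → F)} (hR : IsProjectiveRepresentatives R) (hcard : R.card = 31) :
    weightEnumerator (projReedMuller 3 2 R) = weightForm [1, 0, 0, 0, 0, 0, 0, 0, 0, 0, 0, 0, 0, 0,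
      0, 2480, 15500, 0, 0, 124000, 78120, 558000, 744000, 1116000, 1519000, 1867564, 1488000,
      1116000, 744000, 372000, 4960, 16000] := by
  classical
  have := charP_of_card_eq_five hF
  refine weightEnumerator_eq_weightForm (by rw [Fintype.card_coe, hcard]; rfl) fun w hw => ?_
  rcases Nat.eq_zero_or_pos w with rfl | hw0
  · rw [weightCount_zero]
    rfl
  · obtain ⟨hinj, hrange⟩ := planeCubic_injective_and_range_eq (F := F) (by omega)
    -- The value at this vector is the coefficient of `z ^ 3`, so the words counted are the cubics
    -- monic in `z`. Weights on the full space are four times those on `R`.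
    have hv₀ : (![0, 0, 1] : Fin 3 → F) ≠ 0 := fun h => one_ne_zero (congrFun h 2)
    have h1 := mul_weightCount_homogeneousCode (F := F) (r := 3) (m := 2) (by norm_num) hv₀ (4 * w)
    rw [weightCountAt_eq_card hinj hrange (by simp [planeCubic_apply]), hF] at h1
    have h2 : ∀ a : Fin 9 → F, hammingNorm (planeCubic F (Matrix.vecCons 1 a)) =
        4 * (hammingNorm (planeCubic F (Matrix.vecCons 1 a)) / 4) := fun a => by
      have := card_sub_one_dvd_hammingNorm_planeCubic a
      rw [hF] at this
      exact (Nat.mul_div_cancel' this).symm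
    have h3 : (Finset.univ.filter fun a : Fin 9 → F =>
        hammingNorm (planeCubic F (Matrix.vecCons 1 a)) = 4 * w) =
        Finset.univ.filter fun a : Fin 9 → F =>
          hammingNorm (planeCubic F (Matrix.vecCons 1 a)) / 4 = w :=
      Finset.filter_congr fun a _ => by
        have := h2 a
        omega
    have h4 : ∀ a : Fin 9 → F, hammingNorm (planeCubic F (Matrix.vecCons 1 a)) / 4 < 32 :=
      fun a => by
        have : hammingNorm (planeCubic F (Matrix.vecCons 1 a)) ≤ 125 :=
          hammingNorm_le_card_fintype.trans (by simp [hF])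
        omega
    rw [h3, card_filter_eq_of_sum_pow_eq_ofDigits (by norm_num) (by simp [hF]) h4 (by decide)
      ((sum_pow_hammingNorm_planeCubic hF).trans planeCubicSum_eq)] at h1
    rw [weightCount_projReedMuller (by norm_num) hR, hF]
    refine Nat.eq_of_mul_eq_mul_left (show 0 < 4 * w by omega) (h1.trans ?_)
    -- What remains is arithmetic for the 32 weights, with `124 * 4` as the number of nonzero
    -- vectors times that of units.
    clear h1 h3
    revert w
    decide

end PlaneCubicsFive

/-! ### The five codes -/

theorem mainTheorem3
    (F₄ : Type*) [Field F₄] [Fintype F₄] (hF₄ : Fintype.card F₄ = 4)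
    (F₅ : Type*) [Field F₅] [Fintype F₅] (hF₅ : Fintype.card F₅ = 5) :
    HasTrivialStabilizer (weightEnumerator (reedMuller F₄ 2 2)) ∧
    HasTrivialStabilizer (weightEnumerator (reedMuller F₄ 3 2)) ∧
    HasTrivialStabilizer (weightEnumerator (reedMuller F₅ 2 2)) ∧
    ∀ R : Finset (Fin 3 → F₅), IsProjectiveRepresentatives R →
      HasTrivialStabilizer (weightEnumerator (projReedMuller 3 2 R)) ∧
      dualCode (projReedMuller 3 2 R) = projReedMuller 5 2 R ∧
      HasTrivialStabilizer (weightEnumerator (projReedMuller 5 2 R)) := by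
  have h₄ := hasTrivialStabilizer_reedMuller_of_card_eq_four hF₄
  refine ⟨h₄, ?_, hasTrivialStabilizer_reedMuller_of_card_eq_five hF₅, fun R hR => ?_⟩
  -- Here `2 + 3 < 3 * 2`, and the dimensions are `6 + 10 = 16`.
  · rw [← dualCode_reedMuller (F := F₄) (r := 2) (s := 3) (m := 2) (by omega) (by omega) (by omega)
      (by rw [hF₄]; simp [Finset.sum_range_succ, Nat.multichoose_eq])]
    exact hasTrivialStabilizer_weightEnumerator_dualCode h₄
  · have hcard : R.card = 31 := by
      have := hR.card_mul
      rw [hF₅] at this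
      omega
    have h₅ : HasTrivialStabilizer (weightEnumerator (projReedMuller 3 2 R)) := by
      rw [weightEnumerator_projReedMuller_three_two hF₅ hR hcard]
      exact hasTrivialStabilizer_weightForm_planeCubicFive
    have hdual : dualCode (projReedMuller 3 2 R) = projReedMuller 5 2 R :=
      -- Here `3 + 5 = 8` is divisible by 4 and less than 12, and the dimensions are `10 + 21 = 31`.
      dualCode_projReedMuller hR (by norm_num) (by norm_num) (by omega) (by omega) (by omega)
        (by rw [hF₅]; norm_num) (by rw [hcard, Nat.multichoose_eq, Nat.multichoose_eq]; rfl)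
    exact ⟨h₅, hdual, hdual ▸ hasTrivialStabilizer_weightEnumerator_dualCode h₅⟩
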